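/- Let $L, N \ge 1$ be integers with $2N < L$, and let $\mathcal X_{L,N} = \{(x_1,\dots,x_N)\in\mathbb Z^N : 0\le x_1<\cdots<x_N<L\}$. For $\zeta\in\mathbb C$ with $|\zeta|=1$, $z \in \mathbb C$, $\vec w=(w_1,\dots,w_N)\in\mathbb C^N$ and $X,Y\in\mathcal X_{L,N}$, put $$q_z(w) = 1 - z^L w^{-L}(1-w^{-1})^{-N},\qquad p_z(\vec w;\zeta) = 1+(-1)^N\zeta^L z^{-L}\prod_{i=1}^N (1-w_i^{-1}),\qquad h_{\vec w}(Y)=\prod_{i=1}^N w_i^{y_i},$$ $$u_{\vec w}(X)=\sum_{\sigma\in S_N}(-1)^\sigma\prod_{j=1}^N(1-w_{\sigma(j)}^{-1})^{\sigma(j)-j}\prod_{i=1}^N w_{\sigma(i)}^{-x_i}.$$ Let $\beta,\beta_1,\beta_2$ be real numbers with $\beta>1$, $\frac{L}{L-N}<\beta_1<\frac LN$ and $\frac LN<\beta_2<\frac{L}{N-1}$ (no upper bound on $\beta_2$ if $N=1$). For $\epsilon'>0$ set $R'=1/\epsilon'$, $R=(R')^\beta$, $\epsilon_1=(\epsilon')^{\beta_1}$,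 $\epsilon_2=(\epsilon')^{\beta_2}$, and write $$\oint\!\!\!\!\!-_z=\frac1{2\pi \mathrm i}\Big(\oint_{C_{R'}}-\oint_{C_{\epsilon'}}\Big),\qquad \oint\!\!\!\!\!-_w=\frac1{2\pi \mathrm i}\Big(\oint_{C_R}-\oint_{C_{\epsilon_1}}-\oint_{1+C_{\epsilon_2}}\Big),$$ where $C_r$ is the positively oriented circle of radius $r$ around $0$ and $1+C_r$ its shift by $1$. Then there is $\epsilon_0>0$, depending only on $L,N,\beta,\beta_1,\beta_2$, such that for all $0<\epsilon'<\epsilon_0$ and all $\zeta$ with $|\zeta|=1$: for $z$ and all $w_i$ on these contours one has $z\neq0$, $w_i\notin\{0,1\}$, $q_z(w_i)\ne0$ and $p_z(\vec w;\zeta)\neq0$, so the integrand below has no singularity there; and for all $X,Y\in\mathcal X_{L,N}$, $$\mathbf 1(X=Y)=\oint\!\!\!\!\!-_z\frac{dz}{z}\oint\!\!\!\!\!-_w\frac{dw_1}{w_1}\cdots\oint\!\!\!\!\!-_w\frac{dw_N}{w_N}\;\frac{h_{\vec w}(Y)\,u_{\vec w}(X)}{p_z(\vec w;\zeta)\prod_{i=1}^N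 q_z(w_i)}.$$ The same identity holds with the integrand multiplied by the constant $\prod_{i=1}^N\zeta^{x_i-y_i}$. -/

import Mathlib

noncomputable section

namespace PushASEP

/-- The state space of `N` particles on a ring of length `L`:
integer vectors with `0 ≤ x₁ < x₂ < ⋯ < x_N < L`. -/
def configs (L N : ℕ) : Set (Fin N → ℤ) :=
  {x | StrictMono x ∧ ∀ i, 0 ≤ x i ∧ x i < (L : ℤ)}

/-- `q_z(w) = 1 - z^L w^{-L} (1 - w⁻¹)^{-N}`. -/
def q (L N : ℕ) (z w : ℂ) : ℂ :=
  1 - z ^ L * w ^ (-(L : ℤ)) * (1 - w⁻¹) ^ (-(N : ℤ))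

/-- `p_z(w; ζ) = 1 + (-1)^N ζ^L z^{-L} ∏ᵢ (1 - wᵢ⁻¹)`. -/
def p (L N : ℕ) (ζ z : ℂ) (w : Fin N → ℂ) : ℂ :=
  1 + (-1) ^ N * ζ ^ L * z ^ (-(L : ℤ)) * ∏ i, (1 - (w i)⁻¹)

/-- `h_w(Y) = ∏ᵢ wᵢ^{yᵢ}`. -/
def h {N : ℕ} (w : Fin N → ℂ) (Y : Fin N → ℤ) : ℂ :=
  ∏ i, w i ^ Y i

/-- The amplitude `A_σ(w) = (-1)^σ ∏ⱼ (1 - w_{σ(j)}⁻¹)^{σ(j) - j}`. -/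
def amplitude {N : ℕ} (σ : Equiv.Perm (Fin N)) (w : Fin N → ℂ) : ℂ :=
  ((Equiv.Perm.sign σ : ℤ) : ℂ) *
    ∏ j, (1 - (w (σ j))⁻¹) ^ (((σ j : ℕ) : ℤ) - ((j : ℕ) : ℤ))

/-- The Bethe function `u_w(X) = ∑_σ A_σ(w) ∏ᵢ w_{σ(i)}^{-xᵢ}`. -/
def u {N : ℕ} (w : Fin N → ℂ) (X : Fin N → ℤ) : ℂ :=
  ∑ σ : Equiv.Perm (Fin N), amplitude σ w * ∏ i, w (σ i) ^ (-X i)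

/-- The `z`-contour functional `(2πi)⁻¹ (∮_{C_{R'}} - ∮_{C_{ε'}})`. -/
def zContour (R' ε' : ℝ) (f : ℂ → ℂ) : ℂ :=
  (2 * Real.pi * Complex.I)⁻¹ * ((∮ z in C(0, R'), f z) - ∮ z in C(0, ε'), f z)

/-- The `w`-contour functional `(2πi)⁻¹ (∮_{C_R} - ∮_{C_{ε₁}} - ∮_{1 + C_{ε₂}})`. -/
def wContour (R ε₁ ε₂ : ℝ) (f : ℂ → ℂ) : ℂ :=
  (2 * Real.pi * Complex.I)⁻¹ *
    ((∮ w in C(0, R), f w) - (∮ w in C(0, ε₁), f w) - ∮ w in C(1, ε₂), f w)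

/-- The `n`-fold iterated `w`-contour functional, the first variable being the outermost one. -/
def iterContour (R ε₁ ε₂ : ℝ) : (n : ℕ) → ((Fin n → ℂ) → ℂ) → ℂ
  | 0, f => f Fin.elim0
  | n + 1, f => wContour R ε₁ ε₂ fun w => iterContour R ε₁ ε₂ n fun v => f (Fin.cons w v)

/-- The `(N+1)`-fold contour integral
`∮ dz/z ∮ dw₁/w₁ ⋯ ∮ dw_N/w_N f(z, w)` over the difference contours. -/
def nestedContour (N : ℕ) (R' ε' R ε₁ ε₂ : ℝ) (f : ℂ → (Fin N → ℂ) → ℂ) : ℂ :=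
  zContour R' ε' fun z => z⁻¹ *
    iterContour R ε₁ ε₂ N fun w => (∏ i, (w i)⁻¹) * f z w

/-- The integrand `h_w(Y) u_w(X) / (p_z(w; ζ) ∏ᵢ q_z(wᵢ))`. -/
def integrand (L N : ℕ) (ζ : ℂ) (X Y : Fin N → ℤ) (z : ℂ) (w : Fin N → ℂ) : ℂ :=
  h w Y * u w X / (p L N ζ z w * ∏ i, q L N z (w i))

/-- The support of the `z`-contour. -/
def zSupport (R' ε' : ℝ) : Set ℂ :=
  Metric.sphere 0 R' ∪ Metric.sphere 0 ε'

/-- The support of the `w`-contour. -/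
def wSupport (R ε₁ ε₂ : ℝ) : Set ℂ :=
  Metric.sphere 0 R ∪ Metric.sphere 0 ε₁ ∪ Metric.sphere 1 ε₂

/-- The conditions on the radii at scale `ε'` with exponents `β, β₁, β₂`. The upper bound
`β₂ < L / (N - 1)` is multiplied out, so that it is void for `N = 1`. -/
structure Admissible (L N : ℕ) (β β₁ β₂ R' ε' R ε₁ ε₂ : ℝ) : Prop where
  R'_eq : R' = 1 / ε'
  R_eq : R = R' ^ β
  ε₁_eq : ε₁ = ε' ^ β₁
  ε₂_eq : ε₂ = ε' ^ β₂
  one_lt_β : 1 < β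
  lt_β₁ : (L : ℝ) / ((L : ℝ) - N) < β₁
  β₁_lt : β₁ < (L : ℝ) / N
  lt_β₂ : (L : ℝ) / N < β₂
  β₂_lt : β₂ * ((N : ℝ) - 1) < L

end PushASEP

end

/-! Write `q = 1 - A` with `A = ratio` and `p = 1 - B` with `B = prodRatio`. For small `ε'` the
contours separate the two regimes of each geometric series. `|A|` is at most 1/2 on the large
`w`-circle and at least 2 on the two small ones. `|B|` is at most 1/2 if `|z| = R'` or if all `w i`
lie near 1, and at least 2 if `|z| = ε'` and some `w i` is not near 1. Hence `1/p` and every `1/q`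
expand in powers of `A` and `B`, about 0 or about infinity according to the circles chosen. Once the
permutation `σ`, the set `T` of variables near 1, and the exponents `k i` of `A` and `m` of `B` are
fixed, a term is a product of functions of one variable each; dominated convergence permits termwise
integration (`hasSum_nestedContour`).

The `z`-integral leaves only `m = ∑ k i` and `T ≠ univ` (`multiContour_zTerm`). The `w`-integrals
then kill all but one term (`eq_base_of_term_ne_zero`). A positive `k i` leaves only the large
circle, where the integrand decays like `w⁻²`. A negative `k i` leaves no pole at 0, so `i ∈ T`. A
pole at 1 for every `i ∈ T` contradicts a counting inequality for permutations unless `k = 0`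
(`exponents_eq_zero`). Finally, decay at infinity and absence of poles force interlacing conditions
on `X` and `Y` under which `σ = 1` (`perm_eq_one_of_interlacing`). The surviving term is a product
of residues of `w ^ (Y i - X i - 1)`, which is the indicator of `X = Y`. -/

noncomputable section

namespace PushASEP

open Metric

/-! ### Termwise integration over linear combinations of circles. -/

/-- A linear combination of circle integrals, where the integrand may depend on the circle. -/
def multiContour {J : Type*} [Fintype J] (s c : J → ℂ) (r : J → ℝ) (g : J → ℂ → ℂ) : ℂ :=
  ∑ j, s j * ∮ w in C(c j, r j), g j w

/-- The `n`-fold iteration of `multiContour` on a function that does not depend on the circles. -/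
def iterMultiContour {J : Type*} [Fintype J] (s c : J → ℂ) (r : J → ℝ) :
    (n : ℕ) → ((Fin n → ℂ) → ℂ) → ℂ
  | 0, f => f Fin.elim0
  | n + 1, f => multiContour s c r fun _ w =>
      iterMultiContour s c r n fun v => f (Fin.cons w v)

theorem hasSum_circleIntegral {ι : Type*} [Countable ι] {c : ℂ} {r : ℝ} (hr : 0 ≤ r)
    {F : ι → ℂ → ℂ} {f : ℂ → ℂ} {b : ι → ℝ} (hF : ∀ k, ContinuousOn (F k) (sphere c r))
    (hb : ∀ k, ∀ w ∈ sphere c r, ‖F k w‖ ≤ b k) (hs : Summable b)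
    (hf : ∀ w ∈ sphere c r, HasSum (fun k => F k w) (f w)) :
    HasSum (fun k => ∮ w in C(c, r), F k w) (∮ w in C(c, r), f w) := by
  have hm : ∀ θ, circleMap c r θ ∈ sphere c r := fun θ => circleMap_mem_sphere c hr θ
  unfold circleIntegral
  refine intervalIntegral.hasSum_integral_of_dominated_convergence (fun k _ => r * b k)
    (fun k => ?_) (fun k => ?_) ?_ ?_ ?_
  · refine Continuous.aestronglyMeasurable ?_
    have h1 : Continuous fun θ => F k (circleMap c r θ) :=
      (hF k).comp_continuous (continuous_circleMap c r) hm
    have h2 : Continuous fun θ => deriv (circleMap c r) θ := by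
      simp only [deriv_circleMap]; fun_prop
    exact h2.smul h1
  · refine Filter.Eventually.of_forall fun θ _ => ?_
    rw [norm_smul, deriv_circleMap]
    have : ‖circleMap 0 r θ * Complex.I‖ = r := by simp [abs_of_nonneg hr]
    rw [this]
    exact mul_le_mul_of_nonneg_left (hb k _ (hm θ)) hr
  · exact Filter.Eventually.of_forall fun θ _ => hs.mul_left r
  · exact intervalIntegrable_const
  · exact Filter.Eventually.of_forall fun θ _ => (hf _ (hm θ)).const_smul _

/-- The terms carry the circle `j` as an argument because one function has different expansions on
different circles. The norm bound is kept so that the integrated series can be dominated in the next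
integration. -/
theorem hasSum_multiContour {ι J : Type*} [Countable ι] [Fintype J] {s c : J → ℂ} {r : J → ℝ}
    (hr : ∀ j, 0 ≤ r j) {d : ι → ℂ} {g : ι → J → ℂ → ℂ} {f : J → ℂ → ℂ} {b : ι → ℝ}
    (hg : ∀ k j, ContinuousOn (g k j) (sphere (c j) (r j)))
    (hb : ∀ k j, ∀ w ∈ sphere (c j) (r j), ‖d k * g k j w‖ ≤ b k) (hs : Summable b)
    (hf : ∀ j, ∀ w ∈ sphere (c j) (r j), HasSum (fun k => d k * g k j w) (f j w)) :
    HasSum (fun k => d k * multiContour s c r (g k)) (multiContour s c r f) ∧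
      ∀ k, ‖d k * multiContour s c r (g k)‖ ≤ (∑ j, ‖s j‖ * (2 * Real.pi * r j)) * b k := by
  have e : ∀ k, d k * multiContour s c r (g k) =
      ∑ j, s j * ∮ w in C(c j, r j), d k * g k j w := by
    intro k
    simp only [multiContour, Finset.mul_sum, circleIntegral.integral_const_mul]
    exact Finset.sum_congr rfl fun j _ => by ring
  constructor
  · simp only [e]
    refine hasSum_sum fun j _ => HasSum.mul_left _ ?_
    exact hasSum_circleIntegral (hr j) (fun k => continuousOn_const.mul (hg k j))
      (fun k => hb k j) hs (hf j)
  · intro k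
    rw [e, Finset.sum_mul]
    refine (norm_sum_le _ _).trans (Finset.sum_le_sum fun j _ => ?_)
    rw [norm_mul, mul_assoc]
    exact mul_le_mul_of_nonneg_left
      (circleIntegral.norm_integral_le_of_norm_le_const (hr j) (hb k j)) (norm_nonneg _)

/-- Termwise integration of a series of product functions along an iterated contour. -/
theorem hasSum_iterMultiContour {ι J : Type*} [Countable ι] [Fintype J] {s c : J → ℂ} {r : J → ℝ}
    (hr : ∀ j, 0 ≤ r j) : ∀ (n : ℕ) (d : ι → ℂ) (g : ι → Fin n → J → ℂ → ℂ)
    (f : (Fin n → ℂ) → ℂ) (b : ι → ℝ),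
    (∀ k i j, ContinuousOn (g k i j) (sphere (c j) (r j))) →
    (∀ k (a : Fin n → J) (w : Fin n → ℂ), (∀ i, w i ∈ sphere (c (a i)) (r (a i))) →
      ‖d k * ∏ i, g k i (a i) (w i)‖ ≤ b k) → Summable b →
    (∀ (a : Fin n → J) (w : Fin n → ℂ), (∀ i, w i ∈ sphere (c (a i)) (r (a i))) →
      HasSum (fun k => d k * ∏ i, g k i (a i) (w i)) (f w)) →
    HasSum (fun k => d k * ∏ i, multiContour s c r (g k i)) (iterMultiContour s c r n f) ∧
      ∀ k, ‖d k * ∏ i, multiContour s c r (g k i)‖ ≤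
        (∑ j, ‖s j‖ * (2 * Real.pi * r j)) ^ n * b k := by
  intro n
  induction n with
  | zero =>
    intro d g f b _ hb _ hf
    have h1 := hf Fin.elim0 Fin.elim0 (fun i => i.elim0)
    have h2 := fun k => hb k Fin.elim0 Fin.elim0 (fun i => i.elim0)
    simp only [Finset.univ_eq_empty, Finset.prod_empty, mul_one, pow_zero, one_mul] at h1 h2 ⊢
    exact ⟨h1, h2⟩
  | succ n ih =>
    intro d g f b hg hb hs hf
    set M := ∑ j, ‖s j‖ * (2 * Real.pi * r j)
    -- With the first variable frozen, its factor is absorbed into the coefficient `d k`; the same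
    -- majorant `b` still serves the other variables.
    have key : ∀ j, ∀ w₀ ∈ sphere (c j) (r j),
        HasSum (fun k => (d k * g k 0 j w₀) * ∏ i : Fin n, multiContour s c r (g k i.succ))
          (iterMultiContour s c r n fun v => f (Fin.cons w₀ v)) ∧
        ∀ k, ‖(d k * g k 0 j w₀) * ∏ i : Fin n, multiContour s c r (g k i.succ)‖ ≤
          M ^ n * b k := by
      intro j w₀ hw₀
      refine ih (fun k => d k * g k 0 j w₀) (fun k i => g k i.succ) _ b
        (fun k i j => hg k i.succ j) ?_ hs ?_
      · intro k a w hw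
        have := hb k (Fin.cons j a) (Fin.cons w₀ w) (by
          intro i
          cases i using Fin.cases with
          | zero => rw [Fin.cons_zero, Fin.cons_zero]; exact hw₀
          | succ i => rw [Fin.cons_succ, Fin.cons_succ]; exact hw i)
        simpa only [Fin.prod_univ_succ, Fin.cons_zero, Fin.cons_succ, mul_assoc] using this
      · intro a w hw
        have := hf (Fin.cons j a) (Fin.cons w₀ w) (by
          intro i
          cases i using Fin.cases with
          | zero => rw [Fin.cons_zero, Fin.cons_zero]; exact hw₀
          | succ i => rw [Fin.cons_succ, Fin.cons_succ]; exact hw i)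
        simpa only [Fin.prod_univ_succ, Fin.cons_zero, Fin.cons_succ, mul_assoc] using this
    have e : ∀ k (x : ℂ), (d k * x) * ∏ i : Fin n, multiContour s c r (g k i.succ) =
        (d k * ∏ i : Fin n, multiContour s c r (g k i.succ)) * x := fun k x => by ring
    have := hasSum_multiContour (s := s) hr
      (d := fun k => d k * ∏ i : Fin n, multiContour s c r (g k i.succ))
      (g := fun k => g k 0)
      (f := fun _ w => iterMultiContour s c r n fun v => f (Fin.cons w v))
      (b := fun k => M ^ n * b k) (fun k j => hg k 0 j)
      (fun k j w hw => by rw [← e]; exact (key j w hw).2 k) (hs.mul_left _)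
      (fun j w hw => by simp only [← e]; exact (key j w hw).1)
    simp only [← e] at this
    simp only [Fin.prod_univ_succ, ← mul_assoc, iterMultiContour]
    refine ⟨this.1, fun k => (this.2 k).trans (le_of_eq ?_)⟩
    ring

/-! ### Products of series and the two geometric expansions. -/

theorem mul_hasSum_and_summable {κ κ' : Type*} {f : κ → ℂ} {g : κ' → ℂ} {S S' : ℂ}
    (hf : HasSum f S) (hg : HasSum g S') (hfn : Summable fun x => ‖f x‖)
    (hgn : Summable fun x => ‖g x‖) :
    HasSum (fun x : κ × κ' => f x.1 * g x.2) (S * S') ∧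
      Summable fun x : κ × κ' => ‖f x.1 * g x.2‖ :=
  ⟨hf.mul hg (summable_mul_of_summable_norm hfn hgn), hfn.mul_norm hgn⟩

theorem prod_hasSum_and_summable {κ : Type*} {n : ℕ} {φ : Fin n → κ → ℂ} {S : Fin n → ℂ}
    (h : ∀ i, HasSum (φ i) (S i)) (hn : ∀ i, Summable fun k => ‖φ i k‖) :
    HasSum (fun k : Fin n → κ => ∏ i, φ i (k i)) (∏ i, S i) ∧
      Summable fun k : Fin n → κ => ‖∏ i, φ i (k i)‖ := by
  induction n with
  | zero =>
    constructor
    · simpa only [Finset.univ_eq_empty, Finset.prod_empty, Finset.univ_unique,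
        Finset.sum_singleton] using hasSum_fintype (fun k : Fin 0 → κ => (1 : ℂ))
    · exact Summable.of_finite
  | succ n ih =>
    obtain ⟨h1, h2⟩ := ih (φ := fun i => φ i.succ) (S := fun i => S i.succ) (fun i => h i.succ) (fun i => hn i.succ)
    have h3 := mul_hasSum_and_summable (h 0) h1 (hn 0) h2
    rw [Fin.prod_univ_succ, ← (Fin.consEquiv fun _ => κ).hasSum_iff,
      ← (Fin.consEquiv fun _ => κ).summable_iff]
    simp only [Function.comp_def, Fin.consEquiv_apply, Fin.prod_univ_succ, Fin.cons_zero,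
      Fin.cons_succ]
    exact h3

/-- The coefficients of the expansion of `1 / (1 - A)` in powers of `A`, about `0` or `∞`. -/
def side (b : Bool) (k : ℤ) : ℂ :=
  if b then (if 0 ≤ k then 1 else 0) else (if k < 0 then -1 else 0)

theorem norm_side_mul_zpow_le {b : Bool} {A : ℂ} (h1 : b = true → ‖A‖ ≤ 1 / 2)
    (h2 : b = false → 2 ≤ ‖A‖) (k : ℤ) : ‖side b k * A ^ k‖ ≤ (1 / 2 : ℝ) ^ k.natAbs := by
  cases b with
  | true =>
    rcases le_or_gt 0 k with hk | hk
    · lift k to ℕ using hk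
      simp only [side, if_true, Nat.cast_nonneg, one_mul, zpow_natCast, norm_pow, Int.natAbs_natCast]
      exact pow_le_pow_left₀ (norm_nonneg _) (h1 rfl) _
    · simp [side, not_le.2 hk]
  | false =>
    rcases le_or_gt 0 k with hk | hk
    · simp [side, not_lt.2 hk]
    · obtain ⟨m, rfl⟩ : ∃ m : ℕ, k = -(m : ℤ) := ⟨k.natAbs, by omega⟩
      simp only [side, Bool.false_eq_true, if_false, hk, if_true, zpow_neg, zpow_natCast, norm_mul,
        norm_neg, norm_one, one_mul, norm_inv, norm_pow, Int.natAbs_neg, Int.natAbs_natCast,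
        one_div, inv_pow]
      exact inv_anti₀ (by positivity) (pow_le_pow_left₀ (by norm_num) (h2 rfl) _)

theorem summable_half_pow_natAbs : Summable fun k : ℤ => (1 / 2 : ℝ) ^ k.natAbs := by
  have h := summable_geometric_of_lt_one (r := (1 / 2 : ℝ)) (by norm_num) (by norm_num)
  exact Summable.of_nat_of_neg (by simpa using h) (by simpa using h)

/-- Both expansions are indexed by all of `ℤ`, so contributions of different circles can be combined
exponent by exponent. -/
theorem hasSum_side_mul_zpow {b : Bool} {A : ℂ} (h1 : b = true → ‖A‖ ≤ 1 / 2)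
    (h2 : b = false → 2 ≤ ‖A‖) : HasSum (fun k : ℤ => side b k * A ^ k) (1 - A)⁻¹ := by
  cases b with
  | true =>
    have hA := (h1 rfl).trans_lt (by norm_num : (1 / 2 : ℝ) < 1)
    rw [← (Nat.cast_injective (R := ℤ)).hasSum_iff]
    · simpa [Function.comp_def, side] using hasSum_geometric_of_norm_lt_one hA
    · intro k hk
      have : ¬ 0 ≤ k := fun h => hk ⟨k.toNat, by simp [h]⟩
      simp [side, this]
  | false =>
    have hA := h2 rfl
    have hA0 : A ≠ 0 := by rintro rfl; norm_num at hA
    have hi : ‖A⁻¹‖ < 1 := by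
      rw [norm_inv]; exact inv_lt_one_of_one_lt₀ (by linarith)
    -- The expansion at infinity starts at `A⁻¹`. Exponent 0 thus occurs only in the expansion at 0,
    -- which later removes the small circles when `k i = 0`.
    have hinj : Function.Injective fun m : ℕ => -((m : ℤ) + 1) := fun a b h => by
      simp only at h; omega
    rw [← hinj.hasSum_iff]
    · have h3 := (hasSum_geometric_of_norm_lt_one hi).mul_left (-A⁻¹)
      have e : -A⁻¹ * (1 - A⁻¹)⁻¹ = (1 - A)⁻¹ := by
        rw [neg_mul, ← mul_inv, mul_sub, mul_one, mul_inv_cancel₀ hA0, neg_inv, neg_sub]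
      rw [e] at h3
      have e2 : ((fun k : ℤ => side false k * A ^ k) ∘ fun m : ℕ => -((m : ℤ) + 1)) =
          fun m : ℕ => -A⁻¹ * A⁻¹ ^ m := by
        funext m
        have hm : -((m : ℤ) + 1) < 0 := by omega
        simp only [side, Bool.false_eq_true, if_false, Function.comp_apply, hm, if_true]
        rw [zpow_neg, zpow_add_one₀ hA0, zpow_natCast, mul_inv, inv_pow]
        ring
      rw [e2]
      exact h3
    · intro k hk
      have : ¬ k < 0 := fun h => hk ⟨(-k - 1).toNat, by simp only; omega⟩
      simp [side, this]

theorem summable_norm_side_mul_zpow {b : Bool} {A : ℂ} (h1 : b = true → ‖A‖ ≤ 1 / 2)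
    (h2 : b = false → 2 ≤ ‖A‖) : Summable fun k : ℤ => ‖side b k * A ^ k‖ :=
  summable_half_pow_natAbs.of_nonneg_of_le (fun _ => norm_nonneg _)
    (norm_side_mul_zpow_le h1 h2)

/-! ### Vanishing of the one-variable integrals of `w ^ α * (1 - w⁻¹) ^ β`. -/

theorem zpow_mul_one_sub_inv_zpow {w : ℂ} (hw : w ≠ 0) (α β : ℤ) :
    w ^ α * (1 - w⁻¹) ^ β = w ^ (α - β) * (w - 1) ^ β := by
  have : 1 - w⁻¹ = (w - 1) * w⁻¹ := by field_simp
  rw [this, mul_zpow, inv_zpow', sub_eq_add_neg α β, zpow_add₀ hw]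
  ring

/-- Rewritten as `w ^ (α - β) * (w - 1) ^ β`, the integrand has order `α - β` at 0, so it is
holomorphic in the unit disc. -/
theorem circleIntegral_inner_eq_zero {r : ℝ} (h0 : 0 < r) (h1 : r < 1) {α β : ℤ}
    (h : 0 ≤ α - β) : (∮ w in C(0, r), w ^ α * (1 - w⁻¹) ^ β) = 0 := by
  have e : (∮ w in C(0, r), w ^ α * (1 - w⁻¹) ^ β) =
      ∮ w in C(0, r), w ^ (α - β) * (w - 1) ^ β :=
    circleIntegral.integral_congr h0.le fun w hw =>
      zpow_mul_one_sub_inv_zpow (ne_of_mem_sphere hw h0.ne') α β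
  have hd : DifferentiableOn ℂ (fun w : ℂ => w ^ (α - β) * (w - 1) ^ β) (ball 0 1) := by
    intro w hw
    have hw1 : w - 1 ≠ 0 := by
      intro h'
      rw [sub_eq_zero.1 h'] at hw
      simp at hw
    refine DifferentiableAt.differentiableWithinAt ?_
    exact (differentiableAt_id.zpow (Or.inr h)).mul
      ((differentiableAt_id.sub_const 1).zpow (Or.inl hw1))
  rw [e]
  exact (hd.diffContOnCl_ball (closedBall_subset_ball h1)
    ).circleIntegral_eq_zero h0.le

theorem circleIntegral_one_eq_zero {r : ℝ} (h0 : 0 < r) (h1 : r < 1) {α β : ℤ}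
    (h : 0 ≤ β) : (∮ w in C(1, r), w ^ α * (1 - w⁻¹) ^ β) = 0 := by
  have hd : DifferentiableOn ℂ (fun w : ℂ => w ^ α * (1 - w⁻¹) ^ β) (ball 1 1) := by
    intro w hw
    have hw1 : w ≠ 0 := by
      rintro rfl
      simp at hw
    refine DifferentiableAt.differentiableWithinAt ?_
    exact (differentiableAt_id.zpow (Or.inl hw1)).mul
      (((differentiableAt_inv hw1).const_sub 1).zpow (Or.inr h))
  exact (hd.diffContOnCl_ball (closedBall_subset_ball h1)
    ).circleIntegral_eq_zero h0.le

theorem circleIntegral_polynomial_eq_zero {r : ℝ} (h0 : 0 < r) {α β : ℤ}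
    (h : 0 ≤ α - β) (hβ : 0 ≤ β) : (∮ w in C(0, r), w ^ α * (1 - w⁻¹) ^ β) = 0 := by
  have e : (∮ w in C(0, r), w ^ α * (1 - w⁻¹) ^ β) =
      ∮ w in C(0, r), w ^ (α - β) * (w - 1) ^ β :=
    circleIntegral.integral_congr h0.le fun w hw =>
      zpow_mul_one_sub_inv_zpow (ne_of_mem_sphere hw h0.ne') α β
  have hd : Differentiable ℂ (fun w : ℂ => w ^ (α - β) * (w - 1) ^ β) := fun w =>
    (differentiableAt_id.zpow (Or.inr h)).mul ((differentiableAt_id.sub_const 1).zpow (Or.inr hβ))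
  rw [e]
  exact hd.diffContOnCl.circleIntegral_eq_zero h0.le

theorem one_sub_inv_ne_zero {w : ℂ} (hw : 1 < ‖w‖) : 1 - w⁻¹ ≠ 0 := by
  intro h
  rw [sub_eq_zero, eq_comm, inv_eq_one] at h
  simp [h] at hw

theorem norm_one_sub_inv_zpow_le {w : ℂ} (hw : 2 ≤ ‖w‖) (β : ℤ) :
    ‖(1 - w⁻¹) ^ β‖ ≤ 2 ^ β.natAbs := by
  have hi : ‖w⁻¹‖ ≤ 1 / 2 := by
    rw [norm_inv, one_div]; exact inv_anti₀ (by norm_num) hw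
  have hu : ‖1 - w⁻¹‖ ≤ 2 := (norm_sub_le _ _).trans (by rw [norm_one]; linarith)
  have hl : 1 / 2 ≤ ‖1 - w⁻¹‖ := by
    have := norm_sub_norm_le 1 w⁻¹
    rw [norm_one] at this; linarith
  rw [norm_zpow]
  rcases Int.natAbs_eq β with h | h
  · rw [h, zpow_natCast, Int.natAbs_natCast]
    exact pow_le_pow_left₀ (norm_nonneg _) hu _
  · rw [h, zpow_neg, zpow_natCast, Int.natAbs_neg, Int.natAbs_natCast, ← inv_pow]
    refine pow_le_pow_left₀ (by positivity) ?_ _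
    rw [← inv_inv (2 : ℝ)]
    exact inv_anti₀ (by norm_num) (by simpa using hl)

/-- There is no singularity outside the unit disc and `1 - w⁻¹` tends to 1 at infinity, so the
circle can be enlarged: the integrand is `O(r⁻²)` on a circle of length `2πr`. -/
theorem circleIntegral_outer_eq_zero {R : ℝ} (hR : 1 < R) {α : ℤ} (β : ℤ)
    (h : α ≤ -2) : (∮ w in C(0, R), w ^ α * (1 - w⁻¹) ^ β) = 0 := by
  have hd : ∀ w : ℂ, 1 < ‖w‖ → DifferentiableAt ℂ (fun w : ℂ => w ^ α * (1 - w⁻¹) ^ β) w := by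
    intro w hw
    have hw0 : w ≠ 0 := by rintro rfl; norm_num at hw
    exact (differentiableAt_id.zpow (Or.inl hw0)).mul
      (((differentiableAt_inv hw0).const_sub 1).zpow (Or.inl (one_sub_inv_ne_zero hw)))
  have hconst : ∀ r, R ≤ r → (∮ w in C(0, r), w ^ α * (1 - w⁻¹) ^ β) =
      ∮ w in C(0, R), w ^ α * (1 - w⁻¹) ^ β := by
    intro r hr
    refine Complex.circleIntegral_eq_of_differentiable_on_annulus_off_countable (by linarith) hr
      (s := ∅) Set.countable_empty ?_ ?_
    · intro w hw
      refine (hd w ?_).continuousAt.continuousWithinAt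
      simp only [Set.mem_sdiff, mem_closedBall, dist_zero_right, mem_ball, not_lt] at hw
      linarith [hw.2]
    · intro w hw
      refine hd w ?_
      simp only [Set.mem_sdiff, mem_closedBall, dist_zero_right, mem_ball, not_le] at hw
      linarith [hw.1.2]
  have hbound : ∀ r, max R 2 ≤ r → ‖∮ w in C(0, R), w ^ α * (1 - w⁻¹) ^ β‖ ≤
      (2 * Real.pi * 2 ^ β.natAbs) * r⁻¹ := by
    intro r hr
    have hr2 : 2 ≤ r := (le_max_right _ _).trans hr
    have hr0 : 0 < r := by linarith
    rw [← hconst r ((le_max_left _ _).trans hr)]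
    refine (circleIntegral.norm_integral_le_of_norm_le_const (C := (r⁻¹) ^ 2 * 2 ^ β.natAbs)
      hr0.le fun w hw => ?_).trans (le_of_eq ?_)
    · have hw' : ‖w‖ = r := by simpa using hw
      rw [norm_mul, norm_zpow, hw']
      refine mul_le_mul ?_ (norm_one_sub_inv_zpow_le (by linarith) β) (norm_nonneg _)
        (by positivity)
      calc r ^ α ≤ r ^ (-2 : ℤ) := zpow_le_zpow_right₀ (by linarith) h
        _ = (r⁻¹) ^ 2 := by rw [zpow_neg, inv_pow]; norm_cast
    · field_simp
  have hlim : Filter.Tendsto (fun r : ℝ => (2 * Real.pi * 2 ^ β.natAbs) * r⁻¹) Filter.atTop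
      (nhds ((2 * Real.pi * 2 ^ β.natAbs) * 0)) :=
    tendsto_inv_atTop_zero.const_mul _
  rw [mul_zero] at hlim
  have := ge_of_tendsto hlim (Filter.eventually_atTop.2 ⟨_, hbound⟩)
  exact norm_le_zero_iff.1 this

/-! ### Combinatorics of exponents and permutations. -/

theorem card_mul_sub_one_le_two_mul_sum (S : Finset ℕ) :
    (S.card : ℤ) * (S.card - 1) ≤ 2 * ∑ i ∈ S, (i : ℤ) := by
  induction S using Finset.induction_on_max with
  | empty => simp
  | insert a S ha ih =>
    have hn : a ∉ S := fun h => lt_irrefl _ (ha a h)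
    have hc : S.card ≤ a := by
      have : S ⊆ Finset.range a := fun x hx => Finset.mem_range.2 (ha x hx)
      simpa using Finset.card_le_card this
    rw [Finset.card_insert_of_notMem hn, Finset.sum_insert hn]
    have : (S.card : ℤ) ≤ a := by exact_mod_cast hc
    push_cast
    linarith

/-- The extreme case is `S` lowest and its image highest. Distinct naturals sum to at least `0 + 1 +
⋯`; this is applied to `S` and to the reversed image of `S`. -/
theorem sum_perm_sub_le {N : ℕ} (τ : Equiv.Perm (Fin N)) (S : Finset (Fin N)) :
    ∑ i ∈ S, (((τ i : ℕ) : ℤ) - ((i : ℕ) : ℤ)) ≤ S.card * ((N : ℤ) - S.card) := by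
  have h1 := card_mul_sub_one_le_two_mul_sum (S.map Fin.valEmbedding)
  have hinj : Function.Injective fun i : Fin N => ((Fin.rev (τ i) : Fin N) : ℕ) :=
    Fin.val_injective.comp (Fin.rev_injective.comp τ.injective)
  have h2 := card_mul_sub_one_le_two_mul_sum (S.map ⟨_, hinj⟩)
  rw [Finset.card_map, Finset.sum_map] at h1 h2
  simp only [Fin.valEmbedding_apply, Function.Embedding.coeFn_mk] at h1 h2
  have e : ∀ i, ((Fin.rev (τ i) : ℕ) : ℤ) = (N : ℤ) - 1 - (τ i : ℕ) := by
    intro i; rw [Fin.val_rev]; have := (τ i).isLt; omega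
  simp only [e, Finset.sum_sub_distrib, Finset.sum_const, nsmul_eq_mul] at h1 h2 ⊢
  linarith

/-- A nonzero vector of nonpositive exponents, not all negative, leaves some `w = 1`
contour without pole. -/
theorem exponents_eq_zero {N : ℕ} (τ : Equiv.Perm (Fin N)) (k : Fin N → ℤ)
    (hk : ∀ i, k i ≤ 0) (hne : ∃ i, k i = 0)
    (h : ∀ i, k i < 0 →
      ((i : ℕ) : ℤ) - ((τ i : ℕ) : ℤ) - N * k i + ∑ l, k l < 0) : k = 0 := by
  classical
  set S := Finset.univ.filter fun i => k i < 0 with hS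
  set K := -∑ l, k l with hK
  have hKS : K = ∑ i ∈ S, -k i := by
    rw [hK, ← Finset.sum_neg_distrib]
    refine (Finset.sum_subset (Finset.subset_univ S) fun i _ hi => ?_).symm
    have : ¬ k i < 0 := fun h' => hi (by simp [hS, h'])
    linarith [hk i]
  have hcard : (S.card : ℤ) ≤ K := by
    rw [hKS]
    calc (S.card : ℤ) = ∑ i ∈ S, 1 := by simp
      _ ≤ _ := Finset.sum_le_sum fun i hi => by
        have : k i < 0 := by simpa [hS] using hi
        omega
  have hlt : (S.card : ℤ) < N := by
    obtain ⟨i, hi⟩ := hne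
    have : S.card < (Finset.univ : Finset (Fin N)).card :=
      Finset.card_lt_card (Finset.ssubset_univ_iff.2 fun h' => by
        have : i ∈ S := by rw [h']; simp
        simp [hS, hi] at this)
    simpa using this
  have h1 : ∑ i ∈ S, (N * (-k i) - K + 1) ≤ ∑ i ∈ S, (((τ i : ℕ) : ℤ) - ((i : ℕ) : ℤ)) := by
    refine Finset.sum_le_sum fun i hi => ?_
    have := h i (by simpa [hS] using hi)
    rw [hK]
    linarith
  have h2 := h1.trans (sum_perm_sub_le τ S)
  rw [Finset.sum_add_distrib, Finset.sum_sub_distrib, ← Finset.mul_sum, ← hKS] at h2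
  simp only [Finset.sum_const, nsmul_eq_mul, mul_one] at h2
  -- With `s = S.card`, the summed inequality reads `(N - s) * K + s ≤ s * (N - s)`; since `K ≥ s`
  -- and `N > s`, only `s = 0` is possible.
  have h3 : (S.card : ℤ) ≤ 0 := by nlinarith
  have h4 : S = ∅ := Finset.card_eq_zero.1 (by omega)
  funext i
  have : i ∉ S := by simp [h4]
  have : ¬ k i < 0 := fun h' => this (by simp [hS, h'])
  have := hk i
  simp only [Pi.zero_apply]
  omega

theorem strictMono_sub_le_sub {N : ℕ} {x : Fin N → ℤ} (hx : StrictMono x) {i j : Fin N}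
    (hij : i ≤ j) : x i - ((i : ℕ) : ℤ) ≤ x j - ((j : ℕ) : ℤ) := by
  have key : ∀ d : ℕ, ∀ i j : Fin N, (j : ℕ) = i + d → x i + d ≤ x j := by
    intro d
    induction d with
    | zero => intro i j h; obtain rfl : j = i := Fin.ext h; simp
    | succ d ih =>
      intro i j h
      have h1 := ih i ⟨i + d, by omega⟩ rfl
      have h2 : x ⟨i + d, by omega⟩ < x j := hx (by rw [Fin.lt_def]; simp only; omega)
      push_cast
      omega
  have hij' : (i : ℕ) ≤ j := hij
  have := key (j - i) i j (by omega)
  omega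

/-- At the largest moved index `i`, both `τ i` and `l = τ⁻¹ i` lie below `i`. As `x j - j` is
nondecreasing, `h2` gives `y i ≤ x i`, whereas `h1` at `l` gives `x i ≤ y l < y i`. -/
theorem perm_eq_one_of_interlacing {N : ℕ} {x y : Fin N → ℤ} (hx : StrictMono x)
    (hy : StrictMono y) (τ : Equiv.Perm (Fin N)) (h1 : ∀ i, x (τ i) ≤ y i)
    (h2 : ∀ i, τ i ≤ i → y i - x (τ i) ≤ ((i : ℕ) : ℤ) - ((τ i : ℕ) : ℤ)) : τ = 1 := by
  by_contra hτ
  have hne : (Finset.univ.filter fun i => τ i ≠ i).Nonempty := by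
    by_contra hemp
    rw [Finset.not_nonempty_iff_eq_empty, Finset.filter_eq_empty_iff] at hemp
    exact hτ (Equiv.ext fun i => by simpa using hemp (Finset.mem_univ i))
  obtain ⟨i, hi, hmax⟩ := Finset.exists_max_image _ id hne
  simp only [Finset.mem_filter, Finset.mem_univ, true_and, id] at hi hmax
  have hτi : τ i ≤ i := hmax _ fun h => hi (τ.injective h)
  have hl : τ (τ.symm i) = i := τ.apply_symm_apply i
  have hl' : τ.symm i ≠ i := fun h => hi (by rw [h] at hl; exact hl)
  have hlt : τ.symm i < i := lt_of_le_of_ne (hmax _ (by rw [hl]; exact hl'.symm)) hl'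
  have h3 := h1 (τ.symm i)
  rw [hl] at h3
  have h4 := hy hlt
  have h5 := h2 i hτi
  have h6 := strictMono_sub_le_sub hx hτi
  omega

/-! ### The contours and the factorized terms of the expansion. -/

/-- The ratio `z^L w^{-L} (1 - w⁻¹)^{-N}`, so that `q = 1 - ratio`. -/
def ratio (L N : ℕ) (z w : ℂ) : ℂ :=
  z ^ L * w ^ (-(L : ℤ)) * (1 - w⁻¹) ^ (-(N : ℤ))

/-- The product with `p = 1 - prodRatio`. -/
def prodRatio (L N : ℕ) (ζ z : ℂ) (w : Fin N → ℂ) : ℂ :=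
  -((-1) ^ N * ζ ^ L) * z ^ (-(L : ℤ)) * ∏ i, (1 - (w i)⁻¹)

/-- Quantitative separation of the contours from the zeros of `q` and `p`. -/
structure WellSeparated (L N : ℕ) (R' ε' R ε₁ ε₂ : ℝ) : Prop where
  R'_pos : 0 < R'
  ε'_pos : 0 < ε'
  one_lt_R : 1 < R
  ε₁_pos : 0 < ε₁
  ε₁_lt : ε₁ < 1
  ε₂_pos : 0 < ε₂
  ε₂_lt : ε₂ < 1
  ratio_outer : ∀ z ∈ zSupport R' ε', ∀ w ∈ sphere (0 : ℂ) R, ‖ratio L N z w‖ ≤ 1 / 2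
  ratio_inner : ∀ z ∈ zSupport R' ε', ∀ w ∈ sphere (0 : ℂ) ε₁ ∪ sphere 1 ε₂,
    2 ≤ ‖ratio L N z w‖
  prodRatio_large : ∀ ζ : ℂ, ‖ζ‖ = 1 → ∀ z ∈ sphere (0 : ℂ) R', ∀ w : Fin N → ℂ,
    (∀ i, w i ∈ wSupport R ε₁ ε₂) → ‖prodRatio L N ζ z w‖ ≤ 1 / 2
  prodRatio_small_of_all : ∀ ζ : ℂ, ‖ζ‖ = 1 → ∀ z ∈ sphere (0 : ℂ) ε', ∀ w : Fin N → ℂ,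
    (∀ i, w i ∈ sphere (1 : ℂ) ε₂) → ‖prodRatio L N ζ z w‖ ≤ 1 / 2
  prodRatio_small : ∀ ζ : ℂ, ‖ζ‖ = 1 → ∀ z ∈ sphere (0 : ℂ) ε', ∀ w : Fin N → ℂ,
    (∀ i, w i ∈ wSupport R ε₁ ε₂) → (∃ i, w i ∈ sphere (0 : ℂ) R ∪ sphere 0 ε₁) →
      2 ≤ ‖prodRatio L N ζ z w‖

/-- The centers of the three circles of the `w`-contour. -/
def wCenter : Fin 3 → ℂ := ![0, 0, 1]

/-- The radii of the three circles of the `w`-contour. -/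
def wRadius (R ε₁ ε₂ : ℝ) : Fin 3 → ℝ := ![R, ε₁, ε₂]

/-- The weights of the three circles of the `w`-contour. -/
def wWeight : Fin 3 → ℂ :=
  ![(2 * Real.pi * Complex.I)⁻¹, -(2 * Real.pi * Complex.I)⁻¹, -(2 * Real.pi * Complex.I)⁻¹]

/-- The radii of the two circles of the `z`-contour. -/
def zRadius (R' ε' : ℝ) : Fin 2 → ℝ := ![R', ε']

/-- The weights of the two circles of the `z`-contour. -/
def zWeight : Fin 2 → ℂ := ![(2 * Real.pi * Complex.I)⁻¹, -(2 * Real.pi * Complex.I)⁻¹]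

theorem wContour_eq (R ε₁ ε₂ : ℝ) (f : ℂ → ℂ) :
    wContour R ε₁ ε₂ f = multiContour wWeight wCenter (wRadius R ε₁ ε₂) fun _ => f := by
  simp only [wContour, multiContour, Fin.sum_univ_three, wWeight, wCenter, wRadius,
    Matrix.cons_val]
  ring

theorem zContour_eq (R' ε' : ℝ) (f : ℂ → ℂ) :
    zContour R' ε' f = multiContour zWeight 0 (zRadius R' ε') fun _ => f := by
  simp only [zContour, multiContour, Fin.sum_univ_two, zWeight, zRadius, Matrix.cons_val,
    Pi.zero_apply]
  ring

theorem iterContour_eq (R ε₁ ε₂ : ℝ) (n : ℕ) (f : (Fin n → ℂ) → ℂ) :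
    iterContour R ε₁ ε₂ n f = iterMultiContour wWeight wCenter (wRadius R ε₁ ε₂) n f := by
  induction n with
  | zero => rfl
  | succ n ih => simp only [iterContour, iterMultiContour, wContour_eq, ih]

theorem q_eq (L N : ℕ) (z w : ℂ) : q L N z w = 1 - ratio L N z w := rfl

theorem p_eq (L N : ℕ) (ζ z : ℂ) (w : Fin N → ℂ) : p L N ζ z w = 1 - prodRatio L N ζ z w := by
  simp only [p, prodRatio]; ring

/-- The index set of the series expansion: a permutation, the set of variables on the circle
around `1`, the exponents of the ratios, and the exponent of `prodRatio`. -/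
abbrev Index (N : ℕ) : Type :=
  (Equiv.Perm (Fin N) × Finset (Fin N)) × ((Fin N → ℤ) × ℤ)

/-- The sign of the permutation of an index, as a complex number. -/
def Index.sign {N : ℕ} (I : Index N) : ℂ := ((Equiv.Perm.sign I.1.1 : ℤ) : ℂ)

/-- The `z`-dependence of a term of the expansion. -/
def zTerm (L : ℕ) {N : ℕ} (ζ : ℂ) (I : Index N) (j : Fin 2) (z : ℂ) : ℂ :=
  side (decide (j = 0 ∨ I.1.2 = Finset.univ)) I.2.2 * (-((-1) ^ N * ζ ^ L)) ^ I.2.2 *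
    z ^ ((L : ℤ) * (∑ i, I.2.1 i - I.2.2))

/-- The `w i`-dependence of a term of the expansion. -/
def wTerm (L : ℕ) {N : ℕ} (X Y : Fin N → ℤ) (I : Index N) (i : Fin N) (j : Fin 3) (w : ℂ) : ℂ :=
  (if j = 2 ↔ i ∈ I.1.2 then 1 else 0) * side (decide (j = 0)) (I.2.1 i) *
    (w ^ (Y i - X (I.1.1.symm i) - 1 - L * I.2.1 i) *
      (1 - w⁻¹) ^ (((i : ℕ) : ℤ) - ((I.1.1.symm i : ℕ) : ℤ) - N * I.2.1 i + I.2.2))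

/-- The part of a term of the expansion that does not come from a geometric series. -/
def prefactor {N : ℕ} (X Y : Fin N → ℤ) (σ : Equiv.Perm (Fin N)) (w : Fin N → ℂ) : ℂ :=
  ((Equiv.Perm.sign σ : ℤ) : ℂ) * ∏ i, (w i ^ (Y i - X (σ.symm i) - 1) *
    (1 - (w i)⁻¹) ^ (((i : ℕ) : ℤ) - ((σ.symm i : ℕ) : ℤ)))

theorem sum_prefactor {N : ℕ} (X Y : Fin N → ℤ) {w : Fin N → ℂ} (hw : ∀ i, w i ≠ 0) :
    ∑ σ, prefactor X Y σ w = (∏ i, (w i)⁻¹) * (h w Y * u w X) := by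
  simp only [u, h, Finset.mul_sum, amplitude, prefactor]
  refine Finset.sum_congr rfl fun σ _ => ?_
  have e1 : ∏ j, (1 - (w (σ j))⁻¹) ^ (((σ j : ℕ) : ℤ) - ((j : ℕ) : ℤ)) =
      ∏ i, (1 - (w i)⁻¹) ^ (((i : ℕ) : ℤ) - ((σ.symm i : ℕ) : ℤ)) := by
    rw [← Equiv.prod_comp σ fun i =>
      (1 - (w i)⁻¹) ^ (((i : ℕ) : ℤ) - ((σ.symm i : ℕ) : ℤ))]
    simp
  have e2 : ∏ i, w (σ i) ^ (-X i) = ∏ i, w i ^ (-X (σ.symm i)) := by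
    rw [← Equiv.prod_comp σ (fun i => w i ^ (-X (σ.symm i)))]; simp
  have e3 : ∀ i, w i ^ (Y i - X (σ.symm i) - 1) = (w i)⁻¹ * w i ^ Y i * w i ^ (-X (σ.symm i)) := by
    intro i
    rw [sub_eq_add_neg, zpow_add₀ (hw i), sub_eq_add_neg, zpow_add₀ (hw i), zpow_neg_one]
    ring
  rw [e1, e2]
  simp only [e3, Finset.prod_mul_distrib]
  ring

theorem prod_zpow_eq_zpow_sum {ι : Type*} {z : ℂ} (hz : z ≠ 0) (s : Finset ι) (k : ι → ℤ) :
    ∏ i ∈ s, z ^ k i = z ^ ∑ i ∈ s, k i := by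
  classical
  induction s using Finset.induction_on with
  | empty => simp
  | insert i s hi ih => rw [Finset.prod_insert hi, Finset.sum_insert hi, zpow_add₀ hz, ih]

/-- The choice of expansion of `1/p` depends on all the `w`-circles jointly, which would destroy the
product form. Summing over `T`, with an indicator in each `wTerm` forcing `T` to be the set of
variables on the circle around 1, restores it. -/
theorem term_eq (L : ℕ) {N : ℕ} {ζ z : ℂ} (X Y : Fin N → ℤ) (hz : z ≠ 0)
    (I : Index N) (j : Fin 2) (a : Fin N → Fin 3) {w : Fin N → ℂ} (hw : ∀ i, w i ≠ 0)
    (hw1 : ∀ i, 1 - (w i)⁻¹ ≠ 0) :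
    I.sign * zTerm L ζ I j z * ∏ i, wTerm L X Y I i (a i) (w i) =
      (prefactor X Y I.1.1 w *
        if I.1.2 = Finset.univ.filter (fun i => a i = 2) then 1 else 0) *
      ((∏ i, side (decide (a i = 0)) (I.2.1 i) * ratio L N z (w i) ^ I.2.1 i) *
        (side (decide (j = 0 ∨ Finset.univ.filter (fun i => a i = 2) = Finset.univ)) I.2.2 *
          prodRatio L N ζ z w ^ I.2.2)) := by
  obtain ⟨⟨σ, T⟩, k, m⟩ := I
  have hχ : ∏ i, (if a i = 2 ↔ i ∈ T then (1 : ℂ) else 0) =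
      if T = Finset.univ.filter (fun i => a i = 2) then 1 else 0 := by
    split_ifs with hT
    · exact Finset.prod_eq_one fun i _ => if_pos (by simp [hT])
    · obtain ⟨i, hi⟩ : ∃ i, ¬ (a i = 2 ↔ i ∈ T) := by
        by_contra! hall
        exact hT (Finset.ext fun i => by simp [hall i])
      exact Finset.prod_eq_zero (Finset.mem_univ i) (if_neg hi)
  have hzz : z ^ ((L : ℤ) * (∑ i, k i - m)) = (∏ i, (z ^ L) ^ k i) * (z ^ (-(L : ℤ))) ^ m := by
    rw [prod_zpow_eq_zpow_sum (pow_ne_zero L hz), ← zpow_natCast, ← zpow_mul, ← zpow_mul,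
      ← zpow_add₀ hz]
    congr 1
    ring
  have hwt : ∀ i, w i ^ (Y i - X (σ.symm i) - 1 - L * k i) *
      (1 - (w i)⁻¹) ^ (((i : ℕ) : ℤ) - ((σ.symm i : ℕ) : ℤ) - N * k i + m) =
      (w i ^ (Y i - X (σ.symm i) - 1) * (1 - (w i)⁻¹) ^ (((i : ℕ) : ℤ) - ((σ.symm i : ℕ) : ℤ))) *
      ((w i ^ (-(L : ℤ)) * (1 - (w i)⁻¹) ^ (-(N : ℤ))) ^ k i) * (1 - (w i)⁻¹) ^ m := by
    intro i
    rw [mul_zpow, ← zpow_mul, ← zpow_mul, sub_eq_add_neg _ ((L : ℤ) * k i), zpow_add₀ (hw i),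
      zpow_add₀ (hw1 i), sub_eq_add_neg _ ((N : ℤ) * k i), zpow_add₀ (hw1 i),
      neg_mul, neg_mul]
    ring
  have hr : ∀ i, ratio L N z (w i) ^ k i =
      (z ^ L) ^ k i * (w i ^ (-(L : ℤ)) * (1 - (w i)⁻¹) ^ (-(N : ℤ))) ^ k i := by
    intro i
    rw [← mul_zpow, ratio, mul_assoc]
  have hp : prodRatio L N ζ z w ^ m = (-((-1) ^ N * ζ ^ L)) ^ m * (z ^ (-(L : ℤ))) ^ m *
      ∏ i, (1 - (w i)⁻¹) ^ m := by
    rw [prodRatio, mul_zpow, mul_zpow, Finset.prod_zpow]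
  simp only [Index.sign, zTerm, wTerm, prefactor, hwt, hr, hp, hzz, Finset.prod_mul_distrib, hχ]
  split_ifs with hT
  · rw [hT]; ring
  · ring

section Spheres

variable {R ε₁ ε₂ : ℝ} {j : Fin 3} {w : ℂ}

theorem mem_wSupport (hw : w ∈ sphere (wCenter j) (wRadius R ε₁ ε₂ j)) :
    w ∈ wSupport R ε₁ ε₂ := by
  fin_cases j
  · exact Or.inl (Or.inl hw)
  · exact Or.inl (Or.inr hw)
  · exact Or.inr hw

theorem mem_outer (hw : w ∈ sphere (wCenter j) (wRadius R ε₁ ε₂ j)) (hj : j = 0) :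
    w ∈ sphere (0 : ℂ) R := by
  subst hj; exact hw

theorem mem_inner (hw : w ∈ sphere (wCenter j) (wRadius R ε₁ ε₂ j)) (hj : j ≠ 0) :
    w ∈ sphere (0 : ℂ) ε₁ ∪ sphere 1 ε₂ := by
  fin_cases j
  · exact absurd rfl hj
  · exact Or.inl hw
  · exact Or.inr hw

theorem mem_sphere_one (hw : w ∈ sphere (wCenter j) (wRadius R ε₁ ε₂ j)) (hj : j = 2) :
    w ∈ sphere (1 : ℂ) ε₂ := by
  subst hj; exact hw

theorem mem_sphere_zero (hw : w ∈ sphere (wCenter j) (wRadius R ε₁ ε₂ j)) (hj : j ≠ 2) :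
    w ∈ sphere (0 : ℂ) R ∪ sphere 0 ε₁ := by
  fin_cases j
  · exact Or.inl hw
  · exact Or.inr hw
  · exact absurd rfl hj

theorem mem_zSupport {R' ε' : ℝ} {j : Fin 2} {z : ℂ} (hz : z ∈ sphere (0 : ℂ) (zRadius R' ε' j)) :
    z ∈ zSupport R' ε' := by
  fin_cases j
  · exact Or.inl hz
  · exact Or.inr hz

end Spheres

/-! ### Consequences of separation, and integration of the expansion term by term. -/

namespace WellSeparated

variable {L N : ℕ} {R' ε' R ε₁ ε₂ : ℝ}

theorem z_ne_zero (W : WellSeparated L N R' ε' R ε₁ ε₂) {z : ℂ} (hz : z ∈ zSupport R' ε') :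
    z ≠ 0 := by
  rcases hz with hz | hz
  · exact ne_of_mem_sphere hz W.R'_pos.ne'
  · exact ne_of_mem_sphere hz W.ε'_pos.ne'

theorem w_ne_zero (W : WellSeparated L N R' ε' R ε₁ ε₂) {w : ℂ} (hw : w ∈ wSupport R ε₁ ε₂) :
    w ≠ 0 := by
  rcases hw with (hw | hw) | hw
  · exact ne_of_mem_sphere hw (by linarith [W.one_lt_R])
  · exact ne_of_mem_sphere hw W.ε₁_pos.ne'
  · rintro rfl
    have h1 := W.ε₂_lt
    simp at hw
    linarith

theorem w_ne_one (W : WellSeparated L N R' ε' R ε₁ ε₂) {w : ℂ} (hw : w ∈ wSupport R ε₁ ε₂) :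
    w ≠ 1 := by
  rcases hw with (hw | hw) | hw
  · rintro rfl
    have h1 := W.one_lt_R
    simp at hw
    linarith
  · rintro rfl
    have h1 := W.ε₁_lt
    simp at hw
    linarith
  · exact ne_of_mem_sphere hw W.ε₂_pos.ne'

theorem one_sub_inv_ne_zero (W : WellSeparated L N R' ε' R ε₁ ε₂) {w : ℂ}
    (hw : w ∈ wSupport R ε₁ ε₂) : 1 - w⁻¹ ≠ 0 := by
  intro h
  rw [sub_eq_zero, eq_comm, inv_eq_one] at h
  exact W.w_ne_one hw h

theorem wRadius_pos (W : WellSeparated L N R' ε' R ε₁ ε₂) (j : Fin 3) :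
    0 < wRadius R ε₁ ε₂ j := by
  fin_cases j
  · exact zero_lt_one.trans W.one_lt_R
  · exact W.ε₁_pos
  · exact W.ε₂_pos

theorem zRadius_pos (W : WellSeparated L N R' ε' R ε₁ ε₂) (j : Fin 2) :
    0 < zRadius R' ε' j := by
  fin_cases j
  · exact W.R'_pos
  · exact W.ε'_pos

theorem ratio_le (W : WellSeparated L N R' ε' R ε₁ ε₂) {z : ℂ} (hz : z ∈ zSupport R' ε')
    {j : Fin 3} {w : ℂ} (hw : w ∈ sphere (wCenter j) (wRadius R ε₁ ε₂ j))
    (hj : decide (j = 0) = true) : ‖ratio L N z w‖ ≤ 1 / 2 :=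
  W.ratio_outer z hz w (mem_outer hw (of_decide_eq_true hj))

theorem le_ratio (W : WellSeparated L N R' ε' R ε₁ ε₂) {z : ℂ} (hz : z ∈ zSupport R' ε')
    {j : Fin 3} {w : ℂ} (hw : w ∈ sphere (wCenter j) (wRadius R ε₁ ε₂ j))
    (hj : decide (j = 0) = false) : 2 ≤ ‖ratio L N z w‖ :=
  W.ratio_inner z hz w (mem_inner hw (of_decide_eq_false hj))

theorem prodRatio_le (W : WellSeparated L N R' ε' R ε₁ ε₂) {ζ z : ℂ} (hζ : ‖ζ‖ = 1) {l : Fin 2}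
    (hz : z ∈ sphere (0 : ℂ) (zRadius R' ε' l)) {a : Fin N → Fin 3} {w : Fin N → ℂ}
    (hw : ∀ i, w i ∈ sphere (wCenter (a i)) (wRadius R ε₁ ε₂ (a i)))
    (hl : decide (l = 0 ∨ Finset.univ.filter (fun i => a i = 2) = Finset.univ) = true) :
    ‖prodRatio L N ζ z w‖ ≤ 1 / 2 := by
  by_cases h0 : l = 0
  · subst h0
    exact W.prodRatio_large ζ hζ z hz w fun i => mem_wSupport (hw i)
  · obtain rfl : l = 1 := by omega
    have h2 := (of_decide_eq_true hl).resolve_left h0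
    refine W.prodRatio_small_of_all ζ hζ z hz w fun i => mem_sphere_one (hw i) ?_
    simpa using h2.ge (Finset.mem_univ i)

theorem le_prodRatio (W : WellSeparated L N R' ε' R ε₁ ε₂) {ζ z : ℂ} (hζ : ‖ζ‖ = 1) {l : Fin 2}
    (hz : z ∈ sphere (0 : ℂ) (zRadius R' ε' l)) {a : Fin N → Fin 3} {w : Fin N → ℂ}
    (hw : ∀ i, w i ∈ sphere (wCenter (a i)) (wRadius R ε₁ ε₂ (a i)))
    (hl : decide (l = 0 ∨ Finset.univ.filter (fun i => a i = 2) = Finset.univ) = false) :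
    2 ≤ ‖prodRatio L N ζ z w‖ := by
  obtain ⟨h0, h2⟩ := not_or.1 (of_decide_eq_false hl)
  obtain rfl : l = 1 := by omega
  obtain ⟨i, hi⟩ : ∃ i, a i ≠ 2 := by
    by_contra! h
    exact h2 (Finset.filter_true_of_mem fun i _ => h i)
  exact W.prodRatio_small ζ hζ z hz w (fun i => mem_wSupport (hw i))
    ⟨i, mem_sphere_zero (hw i) hi⟩

theorem exists_prefactor_bound (W : WellSeparated L N R' ε' R ε₁ ε₂) (X Y : Fin N → ℤ)
    (σ : Equiv.Perm (Fin N)) : ∃ C : ℝ, 0 ≤ C ∧ ∀ w : Fin N → ℂ,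
      (∀ i, w i ∈ wSupport R ε₁ ε₂) → ‖prefactor X Y σ w‖ ≤ C := by
  have hK : IsCompact (Set.pi Set.univ fun _ : Fin N => wSupport R ε₁ ε₂) :=
    isCompact_univ_pi fun _ =>
      ((isCompact_sphere 0 R).union (isCompact_sphere 0 ε₁)).union (isCompact_sphere 1 ε₂)
  have hc : ContinuousOn (prefactor X Y σ) (Set.pi Set.univ fun _ : Fin N => wSupport R ε₁ ε₂) := by
    refine continuousOn_const.mul (continuousOn_finsetProd _ fun i _ => ?_)
    have h1 : ContinuousOn (fun w : Fin N → ℂ => w i)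
        (Set.pi Set.univ fun _ : Fin N => wSupport R ε₁ ε₂) := (continuous_apply i).continuousOn
    refine (h1.zpow₀ _ fun w hw => Or.inl (W.w_ne_zero (hw i trivial))).mul ?_
    refine ContinuousOn.zpow₀ ?_ _ fun w hw => Or.inl (W.one_sub_inv_ne_zero (hw i trivial))
    exact continuousOn_const.sub (h1.inv₀ fun w hw => W.w_ne_zero (hw i trivial))
  obtain ⟨C, hC⟩ := hK.exists_bound_of_continuousOn hc
  exact ⟨|C|, abs_nonneg C, fun w hw => (hC w fun i _ => hw i).trans (le_abs_self C)⟩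

theorem continuousOn_wTerm (W : WellSeparated L N R' ε' R ε₁ ε₂) (X Y : Fin N → ℤ) (I : Index N)
    (i : Fin N) (j : Fin 3) :
    ContinuousOn (wTerm L X Y I i j) (sphere (wCenter j) (wRadius R ε₁ ε₂ j)) := by
  have h0 : ∀ w ∈ sphere (wCenter j) (wRadius R ε₁ ε₂ j), w ≠ 0 :=
    fun w hw => W.w_ne_zero (mem_wSupport hw)
  have h1 : ∀ w ∈ sphere (wCenter j) (wRadius R ε₁ ε₂ j), 1 - w⁻¹ ≠ 0 :=
    fun w hw => W.one_sub_inv_ne_zero (mem_wSupport hw)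
  refine continuousOn_const.mul ((continuousOn_id.zpow₀ _ fun w hw => Or.inl (h0 w hw)).mul ?_)
  exact (continuousOn_const.sub (continuousOn_id.inv₀ h0)).zpow₀ _ fun w hw => Or.inl (h1 w hw)

theorem continuousOn_zTerm (W : WellSeparated L N R' ε' R ε₁ ε₂) (ζ : ℂ) (I : Index N)
    (j : Fin 2) : ContinuousOn (zTerm L ζ I j) (sphere 0 (zRadius R' ε' j)) :=
  continuousOn_const.mul (continuousOn_id.zpow₀ _ fun _ hz =>
    Or.inl (W.z_ne_zero (mem_zSupport hz)))

end WellSeparated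

theorem summable_prod_of_nonneg {κ : Type*} (N : ℕ) {ψ : κ → ℝ} (h0 : ∀ k, 0 ≤ ψ k)
    (hs : Summable ψ) : Summable fun k : Fin N → κ => ∏ i, ψ (k i) := by
  have hn : Summable fun k => ‖(ψ k : ℂ)‖ := by
    simpa only [Complex.norm_real, Real.norm_of_nonneg (h0 _)] using hs
  have := (prod_hasSum_and_summable (n := N) (φ := fun _ k => (ψ k : ℂ))
    (S := fun _ => ∑' k, (ψ k : ℂ)) (fun _ => hn.of_norm.hasSum) (fun _ => hn)).2
  simpa only [norm_prod, Complex.norm_real, Real.norm_of_nonneg (h0 _)] using this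

theorem summable_index_bound {N : ℕ} {C : Equiv.Perm (Fin N) → ℝ} (hC : ∀ σ, 0 ≤ C σ) :
    Summable fun I : Index N => C I.1.1 *
      ((∏ i, (1 / 2 : ℝ) ^ (I.2.1 i).natAbs) * (1 / 2 : ℝ) ^ I.2.2.natAbs) := by
  refine Summable.mul_of_nonneg (f := fun s : Equiv.Perm (Fin N) × Finset (Fin N) => C s.1)
    (g := fun t : (Fin N → ℤ) × ℤ =>
      (∏ i, (1 / 2 : ℝ) ^ (t.1 i).natAbs) * (1 / 2 : ℝ) ^ t.2.natAbs)
    Summable.of_finite ?_ (fun s => hC s.1) (fun t => by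
      simp only [Pi.zero_apply]; positivity)
  exact Summable.mul_of_nonneg (f := fun k : Fin N → ℤ => ∏ i, (1 / 2 : ℝ) ^ (k i).natAbs)
    (g := fun m : ℤ => (1 / 2 : ℝ) ^ m.natAbs) 
    (summable_prod_of_nonneg N (ψ := fun m : ℤ => (1 / 2 : ℝ) ^ m.natAbs) (fun k => by positivity) summable_half_pow_natAbs)
    summable_half_pow_natAbs (fun k => by simp only [Pi.zero_apply]; positivity)
    (fun m => by simp only [Pi.zero_apply]; positivity)

namespace WellSeparated

variable {L N : ℕ} {R' ε' R ε₁ ε₂ : ℝ}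

theorem norm_term_le (W : WellSeparated L N R' ε' R ε₁ ε₂) {ζ z : ℂ} (hζ : ‖ζ‖ = 1)
    (X Y : Fin N → ℤ) {l : Fin 2} (hz : z ∈ sphere (0 : ℂ) (zRadius R' ε' l))
    {a : Fin N → Fin 3} {w : Fin N → ℂ}
    (hw : ∀ i, w i ∈ sphere (wCenter (a i)) (wRadius R ε₁ ε₂ (a i))) (I : Index N) {C : ℝ}
    (hC : 0 ≤ C) (hp : ‖prefactor X Y I.1.1 w‖ ≤ C) :
    ‖I.sign * zTerm L ζ I l z * ∏ i, wTerm L X Y I i (a i) (w i)‖ ≤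
      C * ((∏ i, (1 / 2 : ℝ) ^ (I.2.1 i).natAbs) * (1 / 2 : ℝ) ^ I.2.2.natAbs) := by
  have hzS := mem_zSupport hz
  rw [term_eq L X Y (W.z_ne_zero hzS) I l a (fun i => W.w_ne_zero (mem_wSupport (hw i)))
    (fun i => W.one_sub_inv_ne_zero (mem_wSupport (hw i))), norm_mul, norm_mul, norm_mul]
  refine mul_le_mul ?_ (mul_le_mul ?_ ?_ (norm_nonneg _) ?_) ?_ hC
  · refine (mul_le_of_le_one_right (norm_nonneg _) ?_).trans hp
    split_ifs <;> simp
  · rw [norm_prod]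
    exact Finset.prod_le_prod (fun _ _ => norm_nonneg _) fun i _ =>
      norm_side_mul_zpow_le (W.ratio_le hzS (hw i)) (W.le_ratio hzS (hw i)) _
  · exact norm_side_mul_zpow_le (W.prodRatio_le hζ hz hw) (W.le_prodRatio hζ hz hw) _
  · positivity
  · positivity

theorem hasSum_term (W : WellSeparated L N R' ε' R ε₁ ε₂) {ζ z : ℂ} (hζ : ‖ζ‖ = 1)
    (X Y : Fin N → ℤ) {l : Fin 2} (hz : z ∈ sphere (0 : ℂ) (zRadius R' ε' l))
    {a : Fin N → Fin 3} {w : Fin N → ℂ}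
    (hw : ∀ i, w i ∈ sphere (wCenter (a i)) (wRadius R ε₁ ε₂ (a i))) :
    HasSum (fun I : Index N => I.sign * zTerm L ζ I l z * ∏ i, wTerm L X Y I i (a i) (w i))
      ((∏ i, (w i)⁻¹) * integrand L N ζ X Y z w) := by
  have hzS := mem_zSupport hz
  have hw0 := fun i => W.w_ne_zero (mem_wSupport (hw i))
  simp only [fun I => term_eq L X Y (ζ := ζ) (W.z_ne_zero hzS) I l a hw0
    (fun i => W.one_sub_inv_ne_zero (mem_wSupport (hw i)))]
  have h1 := hasSum_fintype fun s : Equiv.Perm (Fin N) × Finset (Fin N) =>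
    prefactor X Y s.1 w * if s.2 = Finset.univ.filter (fun i => a i = 2) then 1 else 0
  have e1 : ∑ s : Equiv.Perm (Fin N) × Finset (Fin N), (prefactor X Y s.1 w *
      if s.2 = Finset.univ.filter (fun i => a i = 2) then 1 else 0) =
      (∏ i, (w i)⁻¹) * (h w Y * u w X) := by
    rw [Fintype.sum_prod_type, ← sum_prefactor X Y hw0]
    simp
  rw [e1] at h1
  have h2 := prod_hasSum_and_summable (n := N)
    (φ := fun i k => side (decide (a i = 0)) k * ratio L N z (w i) ^ k)
    (fun i => hasSum_side_mul_zpow (W.ratio_le hzS (hw i)) (W.le_ratio hzS (hw i)))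
    (fun i => summable_norm_side_mul_zpow (W.ratio_le hzS (hw i)) (W.le_ratio hzS (hw i)))
  have hl := W.prodRatio_le hζ hz hw
  have hs := W.le_prodRatio hζ hz hw
  have h3 := mul_hasSum_and_summable h2.1 (hasSum_side_mul_zpow hl hs) h2.2
    (summable_norm_side_mul_zpow hl hs)
  have h4 := (mul_hasSum_and_summable h1 h3.1 Summable.of_finite h3.2).1
  convert h4 using 1
  simp only [integrand, p_eq, q_eq, div_eq_mul_inv, mul_inv, Finset.prod_inv_distrib]
  ring

theorem hasSum_nestedContour (W : WellSeparated L N R' ε' R ε₁ ε₂) {ζ : ℂ} (hζ : ‖ζ‖ = 1)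
    (X Y : Fin N → ℤ) :
    HasSum (fun I : Index N =>
      (I.sign * ∏ i, multiContour wWeight wCenter (wRadius R ε₁ ε₂) (wTerm L X Y I i)) *
        multiContour zWeight 0 (zRadius R' ε') fun j z => z⁻¹ * zTerm L ζ I j z)
      (nestedContour N R' ε' R ε₁ ε₂ (integrand L N ζ X Y)) := by
  choose C hC0 hC using W.exists_prefactor_bound X Y
  have hb := summable_index_bound hC0
  -- The majorant does not depend on `z`, so it also dominates the outer integration.
  have inner : ∀ (l : Fin 2), ∀ z ∈ sphere (0 : ℂ) (zRadius R' ε' l), _ := fun l z hz =>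
    hasSum_iterMultiContour (s := wWeight) (c := wCenter) (r := wRadius R ε₁ ε₂)
      (fun j => (W.wRadius_pos j).le) N (fun I : Index N => I.sign * zTerm L ζ I l z)
      (fun I => wTerm L X Y I) (fun w => (∏ i, (w i)⁻¹) * integrand L N ζ X Y z w) _
      (fun I => W.continuousOn_wTerm X Y I)
      (fun I a w hw => W.norm_term_le hζ X Y hz hw I (hC0 I.1.1)
        (hC I.1.1 w fun i => mem_wSupport (hw i))) hb
      (fun a w hw => W.hasSum_term hζ X Y hz hw)
  obtain ⟨D, hD⟩ : ∃ D : ℝ, ∀ l, ∀ z ∈ sphere (0 : ℂ) (zRadius R' ε' l), ‖z⁻¹‖ ≤ D := by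
    refine ⟨∑ l, (zRadius R' ε' l)⁻¹, fun l z hz => ?_⟩
    rw [norm_inv, mem_sphere_zero_iff_norm.1 hz]
    exact Finset.single_le_sum (f := fun l => (zRadius R' ε' l)⁻¹)
      (fun l _ => (inv_pos.2 (W.zRadius_pos l)).le) (Finset.mem_univ l)
  have e : ∀ (I : Index N) l (z : ℂ),
      (I.sign * ∏ i, multiContour wWeight wCenter (wRadius R ε₁ ε₂) (wTerm L X Y I i)) *
        (z⁻¹ * zTerm L ζ I l z) = z⁻¹ * (I.sign * zTerm L ζ I l z *
          ∏ i, multiContour wWeight wCenter (wRadius R ε₁ ε₂) (wTerm L X Y I i)) :=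
    fun I l z => by ring
  unfold nestedContour
  rw [zContour_eq]
  refine (hasSum_multiContour (s := zWeight) (c := 0) (r := zRadius R' ε')
    (fun l => (W.zRadius_pos l).le)
    (d := fun I : Index N =>
      I.sign * ∏ i, multiContour wWeight wCenter (wRadius R ε₁ ε₂) (wTerm L X Y I i))
    (g := fun I j z => z⁻¹ * zTerm L ζ I j z) (b := fun I => D *
      ((∑ j, ‖wWeight j‖ * (2 * Real.pi * wRadius R ε₁ ε₂ j)) ^ N * (C I.1.1 *
        ((∏ i, (1 / 2 : ℝ) ^ (I.2.1 i).natAbs) * (1 / 2 : ℝ) ^ I.2.2.natAbs)))) ?_ ?_ ?_ ?_).1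
  · exact fun I l => (continuousOn_id.inv₀ fun z hz =>
      W.z_ne_zero (mem_zSupport hz)).mul (W.continuousOn_zTerm ζ I l)
  · intro I l z hz
    rw [e, norm_mul]
    exact mul_le_mul (hD l z hz) ((inner l z hz).2 I) (norm_nonneg _)
      ((norm_nonneg _).trans (hD l z hz))
  · exact (hb.mul_left _).mul_left D
  · intro l z hz
    simp only [e, iterContour_eq]
    exact (inner l z hz).1.mul_left _

end WellSeparated

/-! ### Evaluation of the individual terms. -/

theorem circleIntegral_zpow {r : ℝ} (hr : r ≠ 0) (n : ℤ) :
    (∮ z in C(0, r), z ^ n) = if n = -1 then 2 * Real.pi * Complex.I else 0 := by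
  split_ifs with h
  · subst h
    simpa [zpow_neg_one] using circleIntegral.integral_sub_center_inv (0 : ℂ) hr
  · simpa using circleIntegral.integral_sub_zpow_of_ne h 0 0 r

/-- A residue at 0 requires exponent -1, hence `∑ k i = m`. If `T = univ`, both circles use the same
expansion and cancel; otherwise the coefficients differ by `side true m - side false m = 1`. -/
theorem multiContour_zTerm {L N : ℕ} {R' ε' : ℝ} (hL : L ≠ 0) (hR' : 0 < R') (hε' : 0 < ε')
    (ζ : ℂ) (I : Index N) :
    (multiContour zWeight 0 (zRadius R' ε') fun j z => z⁻¹ * zTerm L ζ I j z) =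
      if ∑ i, I.2.1 i = I.2.2 ∧ I.1.2 ≠ Finset.univ
        then (-((-1) ^ N * ζ ^ L)) ^ I.2.2 else 0 := by
  have key : ∀ (j : Fin 2) (r : ℝ), 0 < r → (∮ z in C(0, r), z⁻¹ * zTerm L ζ I j z) =
      side (decide (j = 0 ∨ I.1.2 = Finset.univ)) I.2.2 * (-((-1) ^ N * ζ ^ L)) ^ I.2.2 *
        if ∑ i, I.2.1 i = I.2.2 then 2 * Real.pi * Complex.I else 0 := by
    intro j r hr
    have e : (∮ z in C(0, r), z⁻¹ * zTerm L ζ I j z) = ∮ z in C(0, r),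
        side (decide (j = 0 ∨ I.1.2 = Finset.univ)) I.2.2 * (-((-1) ^ N * ζ ^ L)) ^ I.2.2 *
          z ^ ((L : ℤ) * (∑ i, I.2.1 i - I.2.2) - 1) := by
      refine circleIntegral.integral_congr hr.le fun z hz => ?_
      simp only [zTerm]
      rw [zpow_sub_one₀ (ne_of_mem_sphere hz hr.ne')]
      ring
    rw [e, circleIntegral.integral_const_mul, circleIntegral_zpow hr.ne']
    congr 1
    refine if_congr ?_ rfl rfl
    rw [sub_eq_neg_self, mul_eq_zero, sub_eq_zero]
    simp [hL]
  have hpi : (2 * Real.pi * Complex.I : ℂ) ≠ 0 := Complex.two_pi_I_ne_zero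
  simp only [multiContour, Fin.sum_univ_two, zWeight, zRadius, Matrix.cons_val, Pi.zero_apply,
    key 0 R' hR', key 1 ε' hε']
  by_cases hT : I.1.2 = Finset.univ
  · have hn : ¬ (∑ i, I.2.1 i = I.2.2 ∧ I.1.2 ≠ Finset.univ) := fun h => h.2 hT
    rw [if_neg hn]
    simp only [hT, or_true]
    ring
  · by_cases hk : ∑ i, I.2.1 i = I.2.2
    · have hs : side true I.2.2 - side false I.2.2 = 1 := by
        by_cases h : 0 ≤ I.2.2
        · simp [side, h]
        · simp [side, h, not_le.1 h]
      simp only [hk, hT, decide_true, if_true, ne_eq, not_false_eq_true, and_self,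
        one_ne_zero, or_false, decide_false]
      linear_combination (side true I.2.2 - side false I.2.2) * (-((-1) ^ N * ζ ^ L)) ^ I.2.2 *
        inv_mul_cancel₀ hpi + (-((-1) ^ N * ζ ^ L)) ^ I.2.2 * hs
    · simp [hk]

theorem multiContour_wTerm {L N : ℕ} {R ε₁ ε₂ : ℝ} (X Y : Fin N → ℤ) (I : Index N) (i : Fin N) :
    multiContour wWeight wCenter (wRadius R ε₁ ε₂) (wTerm L X Y I i) =
      let α := Y i - X (I.1.1.symm i) - 1 - L * I.2.1 i
      let β := ((i : ℕ) : ℤ) - ((I.1.1.symm i : ℕ) : ℤ) - N * I.2.1 i + I.2.2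
      (2 * Real.pi * Complex.I)⁻¹ * if i ∈ I.1.2 then
        -(side false (I.2.1 i) * ∮ w in C(1, ε₂), w ^ α * (1 - w⁻¹) ^ β)
      else side true (I.2.1 i) * (∮ w in C(0, R), w ^ α * (1 - w⁻¹) ^ β) -
        side false (I.2.1 i) * ∮ w in C(0, ε₁), w ^ α * (1 - w⁻¹) ^ β := by
  simp only [multiContour, Fin.sum_univ_three, wWeight, wCenter, wRadius, Matrix.cons_val, wTerm,
    circleIntegral.integral_const_mul]
  by_cases hi : i ∈ I.1.2
  · simp [hi]
  · simp [hi]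
    ring

/-- The only index that contributes to the contour integral. -/
def Index.base (N : ℕ) : Index N := ((1, ∅), (0, 0))

theorem configs_le {L N : ℕ} {x : Fin N → ℤ} (hx : x ∈ configs L N) (i : Fin N) :
    ((i : ℕ) : ℤ) ≤ x i ∧ x i ≤ (L : ℤ) - N + i := by
  have hN : 0 < N := i.pos
  have h0 := strictMono_sub_le_sub hx.1 (i := ⟨0, hN⟩) (j := i) (Fin.mk_le_of_le_val (Nat.zero_le _))
  have h1 := strictMono_sub_le_sub hx.1 (i := i) (j := ⟨N - 1, by omega⟩)
    (by rw [Fin.le_def]; simp only; omega)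
  have h2 := hx.2 ⟨0, hN⟩
  have h3 := hx.2 ⟨N - 1, by omega⟩
  simp only at h0 h1
  omega

theorem eq_base_of_term_ne_zero {L N : ℕ} {R' ε' R ε₁ ε₂ : ℝ} (hNL : N ≤ L) (hL : L ≠ 0)
    (hR' : 0 < R') (hε' : 0 < ε') (hR : 1 < R) (h1 : 0 < ε₁) (h1' : ε₁ < 1) (h2 : 0 < ε₂)
    (h2' : ε₂ < 1) {ζ : ℂ} {X Y : Fin N → ℤ} (hX : X ∈ configs L N) (hY : Y ∈ configs L N)
    {I : Index N}
    (hw : ∀ i, multiContour wWeight wCenter (wRadius R ε₁ ε₂) (wTerm L X Y I i) ≠ 0)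
    (hz : (multiContour zWeight 0 (zRadius R' ε') fun j z => z⁻¹ * zTerm L ζ I j z) ≠ 0) :
    I = Index.base N := by
  obtain ⟨⟨σ, T⟩, k, m⟩ := I
  rw [multiContour_zTerm hL hR' hε'] at hz
  obtain ⟨⟨hm, hT⟩, -⟩ := ite_ne_right_iff.1 hz
  simp only at hm
  subst hm
  simp only [multiContour_wTerm] at hw
  simp only [ne_eq] at hT
  have hk : ∀ i, k i ≤ 0 := by
    intro i
    by_contra! hi
    refine hw i ?_
    have hX' := hX.2 (σ.symm i)
    have hY' := hY.2 i
    -- As `Y i - X (σ.symm i) ≤ L - 1`, the exponent of `w` is at most `(L - 1) - 1 - L = -2`.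
    have hLk : (L : ℤ) ≤ L * k i := le_mul_of_one_le_right (by positivity) hi
    rw [circleIntegral_outer_eq_zero hR _ (by omega)]
    simp [side, not_lt.2 hi.le]
  have hmem : ∀ i, i ∈ T ↔ k i < 0 := by
    intro i
    constructor
    · intro hi
      by_contra! hki
      exact hw i (by simp [hi, side, not_lt.2 hki])
    · intro hki
      by_contra hi
      refine hw i ?_
      have hK : ∑ l, k l ≤ k i := by
        rw [← Finset.add_sum_erase _ _ (Finset.mem_univ i)]
        have := Finset.sum_nonpos (s := Finset.univ.erase i) fun l _ => hk l
        linarith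
      have hX' := configs_le hX (σ.symm i)
      have hY' := configs_le hY i
      -- The order at 0 is at least `(L - N) * (-k i - 1) + (-k i - 1)`, because `Y i - i ≥ 0`, `X j
      -- - j ≤ L - N` and `∑ k l ≤ k i`.
      have hp : 0 ≤ ((L : ℤ) - N) * (-k i - 1) :=
        mul_nonneg (by omega) (by omega)
      rw [circleIntegral_inner_eq_zero h1 h1' (by linarith)]
      simp [hi, side, hki]
  have hk0 : k = 0 := by
    refine exponents_eq_zero σ.symm k hk ?_ ?_
    · by_contra! h
      exact hT (Finset.eq_univ_of_forall fun i => (hmem i).2 (lt_of_le_of_ne (hk i) (h i)))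
    · intro i hi
      by_contra! hβ
      refine hw i ?_
      rw [circleIntegral_one_eq_zero h2 h2' hβ]
      simp [(hmem i).2 hi]
  subst hk0
  have hT0 : T = ∅ := Finset.eq_empty_of_forall_notMem fun i hi => by
    simpa using (hmem i).1 hi
  subst hT0
  simp only [Pi.zero_apply, Finset.sum_const_zero, mul_zero, sub_zero, add_zero,
    Finset.notMem_empty, if_false] at hw
  -- Only the large circle remains for each variable.
  have hs0 : side false 0 = 0 := by simp [side]
  simp only [hs0, zero_mul, sub_zero] at hw
  have hσ : σ.symm = 1 := by
    refine perm_eq_one_of_interlacing hX.1 hY.1 σ.symm ?_ ?_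
    · intro i
      by_contra! h
      exact hw i (by rw [circleIntegral_outer_eq_zero hR _ (by omega)]; simp)
    · intro i hi
      by_contra! h
      have hi' : ((σ.symm i : ℕ) : ℤ) ≤ (i : ℕ) := by exact_mod_cast hi
      refine hw i ?_
      rw [circleIntegral_polynomial_eq_zero (by linarith) (by omega) (by omega)]
      simp
  have hσ1 : σ = 1 := by
    rw [← Equiv.symm_symm σ, hσ]; rfl
  simp [Index.base, hσ1]

theorem term_base {L N : ℕ} {R' ε' R ε₁ ε₂ : ℝ} (hN : 1 ≤ N) (hL : L ≠ 0)
    (hR' : 0 < R') (hε' : 0 < ε') (hR : 0 < R) (ζ : ℂ) (X Y : Fin N → ℤ) :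
    ((Index.base N).sign * ∏ i, multiContour wWeight wCenter (wRadius R ε₁ ε₂)
        (wTerm L X Y (Index.base N) i)) *
      (multiContour zWeight 0 (zRadius R' ε') fun j z => z⁻¹ * zTerm L ζ (Index.base N) j z) =
      if X = Y then 1 else 0 := by
  have hw : ∀ i, multiContour wWeight wCenter (wRadius R ε₁ ε₂)
      (wTerm L X Y (Index.base N) i) = if X i = Y i then 1 else 0 := by
    intro i
    rw [multiContour_wTerm]
    have hc : (Y i - X i - 1 = -1) ↔ X i = Y i := by omega
    have hone : (Equiv.symm (1 : Equiv.Perm (Fin N))) i = i := rfl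
    simp only [Index.base, Finset.notMem_empty, if_false, Pi.zero_apply, hone, mul_zero, sub_zero,
      sub_self, add_zero, zpow_zero, mul_one, circleIntegral_zpow hR.ne', hc]
    split_ifs
    · rw [show side true 0 = 1 by simp [side], show side false 0 = 0 by simp [side], one_mul,
        zero_mul, sub_zero, inv_mul_cancel₀ Complex.two_pi_I_ne_zero]
    · simp [side]
  -- For `N = 0` the `z`-contours would cancel here as well; this is where `1 ≤ N` enters.
  have hT : (∅ : Finset (Fin N)) ≠ Finset.univ := by
    intro h
    have : (⟨0, hN⟩ : Fin N) ∈ (∅ : Finset (Fin N)) := by rw [h]; exact Finset.mem_univ _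
    simp at this
  rw [multiContour_zTerm hL hR' hε']
  simp only [hw]
  have hs : (Index.base N).sign = 1 := by simp [Index.sign, Index.base]
  rw [hs, if_pos (by simp [Index.base, hT]), Finset.prod_ite_zero]
  simp [Index.base, funext_iff]

theorem WellSeparated.nestedContour_integrand {L N : ℕ} {R' ε' R ε₁ ε₂ : ℝ}
    (W : WellSeparated L N R' ε' R ε₁ ε₂) (hN : 1 ≤ N) (hNL : N ≤ L) {ζ : ℂ} (hζ : ‖ζ‖ = 1)
    {X Y : Fin N → ℤ} (hX : X ∈ configs L N) (hY : Y ∈ configs L N) :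
    nestedContour N R' ε' R ε₁ ε₂ (integrand L N ζ X Y) = if X = Y then 1 else 0 := by
  have hL : L ≠ 0 := by omega
  refine (W.hasSum_nestedContour hζ X Y).unique ?_
  rw [← term_base (ε₁ := ε₁) (ε₂ := ε₂) hN hL W.R'_pos W.ε'_pos
    (zero_lt_one.trans W.one_lt_R) ζ X Y]
  refine hasSum_single _ fun I hI => ?_
  by_contra hne
  obtain ⟨h1, h2⟩ := mul_ne_zero_iff.1 hne
  exact hI (eq_base_of_term_ne_zero hNL hL W.R'_pos W.ε'_pos W.one_lt_R W.ε₁_pos W.ε₁_lt W.ε₂_pos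
    W.ε₂_lt hX hY (fun i => Finset.prod_ne_zero_iff.1 (mul_ne_zero_iff.1 h1).2 i
      (Finset.mem_univ i)) h2)

/-! ### Constant factors, and separation of the contours for small `ε'`. -/

theorem circleIntegral_mul_const (f : ℂ → ℂ) (a c : ℂ) (R : ℝ) :
    (∮ z in C(c, R), f z * a) = (∮ z in C(c, R), f z) * a := by
  simp only [mul_comm _ a, circleIntegral.integral_const_mul]

theorem iterContour_mul_const (R ε₁ ε₂ : ℝ) (c : ℂ) (n : ℕ) (f : (Fin n → ℂ) → ℂ) :
    iterContour R ε₁ ε₂ n (fun w => f w * c) = iterContour R ε₁ ε₂ n f * c := by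
  induction n with
  | zero => rfl
  | succ n ih =>
    simp only [iterContour, ih, wContour, circleIntegral_mul_const]
    ring

theorem nestedContour_mul_const (N : ℕ) (R' ε' R ε₁ ε₂ : ℝ) (c : ℂ)
    (f : ℂ → (Fin N → ℂ) → ℂ) :
    nestedContour N R' ε' R ε₁ ε₂ (fun z w => f z w * c) =
      nestedContour N R' ε' R ε₁ ε₂ f * c := by
  simp only [nestedContour, ← mul_assoc, iterContour_mul_const, zContour,
    circleIntegral_mul_const]
  ring

theorem one_sub_ne_zero_of_norm {A : ℂ} (h : ‖A‖ ≤ 1 / 2 ∨ 2 ≤ ‖A‖) : 1 - A ≠ 0 := by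
  intro h0
  rw [← sub_eq_zero.1 h0] at h
  norm_num at h

theorem norm_one_sub_inv_mem_of_two_le {w : ℂ} (hw : 2 ≤ ‖w‖) :
    1 / 2 ≤ ‖1 - w⁻¹‖ ∧ ‖1 - w⁻¹‖ ≤ 2 := by
  have hi : ‖w⁻¹‖ ≤ 1 / 2 := by
    rw [norm_inv, one_div]; exact inv_anti₀ (by norm_num) hw
  have h1 := norm_sub_le 1 w⁻¹
  have h2 := norm_sub_norm_le 1 w⁻¹
  rw [norm_one] at h1 h2
  constructor <;> linarith

theorem norm_one_sub_inv_mem_of_norm_eq {w : ℂ} {r : ℝ} (h0 : 0 < r) (hr : r ≤ 1 / 2)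
    (hw : ‖w‖ = r) : 1 / 2 ≤ ‖1 - w⁻¹‖ ∧ ‖1 - w⁻¹‖ ≤ 2 / r := by
  have hi : ‖w⁻¹‖ = r⁻¹ := by rw [norm_inv, hw]
  have h2r : 2 ≤ r⁻¹ := by
    rw [← inv_inv (2 : ℝ)]; exact inv_anti₀ h0 (by simpa using hr)
  have h1 := norm_sub_le 1 w⁻¹
  have h2 := norm_sub_norm_le w⁻¹ 1
  rw [norm_sub_rev] at h2
  rw [norm_one] at h1 h2
  rw [div_eq_mul_inv 2 r]
  constructor <;> linarith

theorem norm_one_sub_inv_mem_of_near_one {w : ℂ} {r : ℝ} (hr : r ≤ 1 / 2)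
    (hw : ‖w - 1‖ = r) : ‖w‖ ≤ 2 ∧ r / 2 ≤ ‖1 - w⁻¹‖ ∧ ‖1 - w⁻¹‖ ≤ 2 * r := by
  have h1 := norm_sub_norm_le w 1
  have h2 := norm_sub_norm_le 1 w
  rw [norm_sub_rev 1 w] at h2
  rw [norm_one, hw] at h1 h2
  have hw0 : w ≠ 0 := by rintro rfl; rw [norm_zero] at h2; linarith
  have hr0 : 0 ≤ r := hw ▸ norm_nonneg _
  have e : ‖1 - w⁻¹‖ = r / ‖w‖ := by
    rw [← hw, ← norm_div]; congr 1; field_simp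
  refine ⟨by linarith, ?_, ?_⟩
  · rw [e]
    exact div_le_div_of_nonneg_left hr0 (norm_pos_iff.2 hw0) (by linarith)
  · rw [e, div_le_iff₀ (norm_pos_iff.2 hw0)]
    nlinarith

theorem norm_ratio (L N : ℕ) (z w : ℂ) :
    ‖ratio L N z w‖ = ‖z‖ ^ L / (‖w‖ ^ L * ‖1 - w⁻¹‖ ^ N) := by
  simp only [ratio, zpow_neg, zpow_natCast, norm_mul, norm_inv, norm_pow]
  rw [div_eq_mul_inv, mul_inv, mul_assoc]

theorem norm_prodRatio (L N : ℕ) {ζ : ℂ} (hζ : ‖ζ‖ = 1) (z : ℂ) (w : Fin N → ℂ) :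
    ‖prodRatio L N ζ z w‖ = (∏ i, ‖1 - (w i)⁻¹‖) / ‖z‖ ^ L := by
  simp only [prodRatio, zpow_neg, zpow_natCast, norm_mul, norm_inv, norm_pow, norm_neg, norm_one,
    one_pow, hζ, norm_prod, one_mul]
  rw [div_eq_mul_inv, mul_comm]

/-- `b1` and `b2` control `ratio` on the circles around 0; `b3` controls it around 1, and also
`prodRatio` when all variables are there. `b4` makes `prodRatio` small for `|z| = R'`. `b5` makes it
large for `|z| = ε'` when at most `N - 1` variables are near 1. -/
theorem wellSeparated_of_bounds {L N : ℕ} {R' ε' R ε₁ ε₂ : ℝ} (hε' : 0 < ε') (hε'1 : ε' ≤ 1)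
    (hR' : R' = 1 / ε') (hR : 2 ≤ R) (h1 : 0 < ε₁) (h1' : ε₁ ≤ 1 / 2) (h2 : 0 < ε₂)
    (h2' : ε₂ ≤ 1 / 2) (b1 : 2 ^ N * R' ^ L ≤ 1 / 2 * R ^ L)
    (b2 : 2 ^ N * ε₁ ^ L ≤ 1 / 2 * (ε' ^ L * ε₁ ^ N))
    (b3 : 2 ^ L * 2 ^ N * ε₂ ^ N ≤ 1 / 2 * ε' ^ L)
    (b4 : 2 ^ N * ε' ^ L ≤ 1 / 2 * ε₁ ^ N)
    (b5 : 2 ^ N * ε' ^ L ≤ 1 / 2 * ε₂ ^ (N - 1)) : WellSeparated L N R' ε' R ε₁ ε₂ := by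
  have hR'0 : 0 < R' := by rw [hR']; positivity
  have hεR : ε' ≤ R' := by
    rw [hR', le_div_iff₀ hε']; nlinarith
  have hz : ∀ z ∈ zSupport R' ε', ε' ≤ ‖z‖ ∧ ‖z‖ ≤ R' := by
    rintro z (hz | hz) <;> rw [mem_sphere_zero_iff_norm] at hz <;> rw [hz]
    · exact ⟨hεR, le_rfl⟩
    · exact ⟨le_rfl, hεR⟩
  have hw : ∀ w ∈ wSupport R ε₁ ε₂, ε₂ / 2 ≤ ‖1 - w⁻¹‖ ∧ ‖1 - w⁻¹‖ ≤ 2 / ε₁ := by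
    -- This makes `2 / ε₁` an upper bound on all three circles, not only on the one of radius `ε₁`.
    have h4 : 4 ≤ 2 / ε₁ := by rw [le_div_iff₀ h1]; linarith
    rintro w ((hw | hw) | hw)
    · rw [mem_sphere_zero_iff_norm] at hw
      have := norm_one_sub_inv_mem_of_two_le (hw ▸ hR)
      constructor <;> linarith
    · rw [mem_sphere_zero_iff_norm] at hw
      have := norm_one_sub_inv_mem_of_norm_eq h1 h1' hw
      constructor <;> linarith
    · rw [mem_sphere_iff_norm] at hw
      have := norm_one_sub_inv_mem_of_near_one h2' hw
      constructor <;> linarith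
  refine ⟨hR'0, hε', by linarith, h1, by linarith, h2, by linarith, ?_, ?_, ?_, ?_, ?_⟩
  · intro z hz' w hw'
    rw [mem_sphere_zero_iff_norm] at hw'
    have hl := (norm_one_sub_inv_mem_of_two_le (hw' ▸ hR)).1
    have hzl : ‖z‖ ^ L ≤ R' ^ L := pow_le_pow_left₀ (norm_nonneg _) (hz z hz').2 L
    have hN : 1 ≤ 2 ^ N * ‖1 - w⁻¹‖ ^ N := by
      rw [← mul_pow]; exact one_le_pow₀ (by linarith)
    rw [norm_ratio, hw', div_le_iff₀ (by positivity)]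
    have hRL : 0 < R ^ L := by positivity
    have h2N : (0 : ℝ) < 2 ^ N := by positivity
    refine le_of_mul_le_mul_left ?_ h2N
    calc 2 ^ N * ‖z‖ ^ L ≤ 2 ^ N * R' ^ L := by gcongr
      _ ≤ 1 / 2 * R ^ L := b1
      _ ≤ 1 / 2 * R ^ L * (2 ^ N * ‖1 - w⁻¹‖ ^ N) := le_mul_of_one_le_right (by positivity) hN
      _ = _ := by ring
  · intro z hz' w hw'
    have hzl : ε' ^ L ≤ ‖z‖ ^ L := pow_le_pow_left₀ hε'.le (hz z hz').1 L
    rw [norm_ratio]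
    rcases hw' with hw' | hw'
    · rw [mem_sphere_zero_iff_norm] at hw'
      obtain ⟨hl, hu⟩ := norm_one_sub_inv_mem_of_norm_eq h1 h1' hw'
      have hpos : 0 < ‖1 - w⁻¹‖ := by linarith
      rw [hw', le_div_iff₀ (by positivity)]
      calc 2 * (ε₁ ^ L * ‖1 - w⁻¹‖ ^ N) ≤ 2 * (ε₁ ^ L * (2 / ε₁) ^ N) := by gcongr
        _ = 2 * (2 ^ N * ε₁ ^ L) / ε₁ ^ N := by rw [div_pow]; ring
        _ ≤ 2 * (1 / 2 * (ε' ^ L * ε₁ ^ N)) / ε₁ ^ N := by gcongr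
        _ = ε' ^ L := by field_simp
        _ ≤ _ := hzl
    · rw [mem_sphere_iff_norm] at hw'
      obtain ⟨hw2, hl, hu⟩ := norm_one_sub_inv_mem_of_near_one h2' hw'
      have hpos : 0 < ‖1 - w⁻¹‖ := by linarith
      have hwpos : 0 < ‖w‖ := by
        rw [norm_pos_iff]; rintro rfl
        rw [zero_sub, norm_neg, norm_one] at hw'; linarith
      rw [le_div_iff₀ (by positivity)]
      calc 2 * (‖w‖ ^ L * ‖1 - w⁻¹‖ ^ N) ≤ 2 * (2 ^ L * (2 * ε₂) ^ N) := by gcongr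
        _ = 2 * (2 ^ L * 2 ^ N * ε₂ ^ N) := by rw [mul_pow]; ring
        _ ≤ 2 * (1 / 2 * ε' ^ L) := by gcongr
        _ = ε' ^ L := by ring
        _ ≤ _ := hzl
  · intro ζ hζ z hz' w hw'
    rw [mem_sphere_zero_iff_norm] at hz'
    rw [norm_prodRatio L N hζ, hz', div_le_iff₀ (by positivity)]
    calc ∏ i, ‖1 - (w i)⁻¹‖ ≤ ∏ _i : Fin N, 2 / ε₁ :=
          Finset.prod_le_prod (fun _ _ => norm_nonneg _) fun i _ => (hw _ (hw' i)).2
      _ = 2 ^ N / ε₁ ^ N := by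
          rw [Finset.prod_const, Finset.card_univ, Fintype.card_fin, div_pow]
      _ ≤ 1 / 2 * R' ^ L := by
          rw [hR', div_pow, one_pow, div_le_iff₀ (by positivity)]
          calc (2 : ℝ) ^ N = 2 ^ N * ε' ^ L / ε' ^ L := by field_simp
            _ ≤ 1 / 2 * ε₁ ^ N / ε' ^ L := by gcongr
            _ = _ := by ring
  · intro ζ hζ z hz' w hw'
    rw [mem_sphere_zero_iff_norm] at hz'
    rw [norm_prodRatio L N hζ, hz', div_le_iff₀ (by positivity)]
    calc ∏ i, ‖1 - (w i)⁻¹‖ ≤ ∏ _i : Fin N, 2 * ε₂ :=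
          Finset.prod_le_prod (fun _ _ => norm_nonneg _) fun i _ =>
            (norm_one_sub_inv_mem_of_near_one h2' (mem_sphere_iff_norm.1 (hw' i))).2.2
      _ = 1 * (2 ^ N * ε₂ ^ N) := by
          rw [Finset.prod_const, Finset.card_univ, Fintype.card_fin, mul_pow, one_mul]
      _ ≤ 2 ^ L * (2 ^ N * ε₂ ^ N) := by
          gcongr
          exact one_le_pow₀ (by norm_num)
      _ ≤ _ := by rw [← mul_assoc]; exact b3
  · rintro ζ hζ z hz' w hw' ⟨i, hi⟩
    rw [mem_sphere_zero_iff_norm] at hz'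
    have hi' : 1 / 2 ≤ ‖1 - (w i)⁻¹‖ := by
      rcases hi with hi | hi <;> rw [mem_sphere_zero_iff_norm] at hi
      · exact (norm_one_sub_inv_mem_of_two_le (hi ▸ hR)).1
      · exact (norm_one_sub_inv_mem_of_norm_eq h1 h1' hi).1
    rw [norm_prodRatio L N hζ, hz', le_div_iff₀ (by positivity)]
    have hN : N = N - 1 + 1 := by have := i.pos; omega
    calc 2 * ε' ^ L = 2 * (2 ^ N * ε' ^ L) / 2 ^ N := by field_simp
      _ ≤ 2 * (1 / 2 * ε₂ ^ (N - 1)) / 2 ^ N := by gcongr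
      _ = 1 / 2 * (ε₂ / 2) ^ (N - 1) := by
          rw [div_pow]
          conv_lhs => rw [hN, pow_succ, Nat.add_sub_cancel]
          field_simp
      _ ≤ ‖1 - (w i)⁻¹‖ * ∏ j ∈ Finset.univ.erase i, ‖1 - (w j)⁻¹‖ := by
          refine mul_le_mul hi' ?_ (by positivity) (norm_nonneg _)
          calc (ε₂ / 2) ^ (N - 1) = ∏ _j ∈ Finset.univ.erase i, ε₂ / 2 := by
                rw [Finset.prod_const, Finset.card_erase_of_mem (Finset.mem_univ i),
                  Finset.card_univ, Fintype.card_fin]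
            _ ≤ _ := Finset.prod_le_prod (fun _ _ => by positivity) fun j _ => (hw _ (hw' j)).1
      _ = _ := Finset.mul_prod_erase _ (fun i => ‖1 - (w i)⁻¹‖) (Finset.mem_univ i)

theorem eventually_mul_rpow_le_half (C : ℝ) {γ : ℝ} (hγ : 0 < γ) :
    ∀ᶠ ε in nhdsWithin (0 : ℝ) (Set.Ioi 0), C * ε ^ γ ≤ 1 / 2 := by
  have h : Filter.Tendsto (fun ε : ℝ => C * ε ^ γ) (nhds 0) (nhds (C * 0 ^ γ)) :=
    ((Real.continuousAt_rpow_const 0 γ (Or.inr hγ.le)).tendsto).const_mul C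
  rw [Real.zero_rpow hγ.ne', mul_zero] at h
  exact (h.eventually (ge_mem_nhds (by norm_num))).filter_mono nhdsWithin_le_nhds

/-- Each required bound reduces to `C * ε ^ γ ≤ 1 / 2`, and each strict inequality on `β`, `β₁`,
`β₂` is the positivity of one exponent `γ`. -/
theorem eventually_wellSeparated {L N : ℕ} (hN : 1 ≤ N) (hNL : 2 * N < L) {β β₁ β₂ : ℝ}
    (hβ : 1 < β) (h1 : (L : ℝ) / ((L : ℝ) - N) < β₁) (h1' : β₁ < (L : ℝ) / N)
    (h2 : (L : ℝ) / N < β₂) (h2' : β₂ * ((N : ℝ) - 1) < L) :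
    ∀ᶠ ε in nhdsWithin (0 : ℝ) (Set.Ioi 0),
      WellSeparated L N (1 / ε) ε ((1 / ε) ^ β) (ε ^ β₁) (ε ^ β₂) := by
  have hN0 : (0 : ℝ) < N := by exact_mod_cast hN
  have hLN : (2 : ℝ) * N < L := by exact_mod_cast hNL
  have hL0 : (0 : ℝ) < L := by linarith
  have hd : (0 : ℝ) < (L : ℝ) - N := by linarith
  rw [div_lt_iff₀ hd] at h1
  rw [lt_div_iff₀ hN0] at h1'
  rw [div_lt_iff₀ hN0] at h2
  have hβ₁ : 0 < β₁ := by
    by_contra! h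
    nlinarith
  have hβ₂ : 0 < β₂ := by
    by_contra! h
    nlinarith
  have hpos : ∀ᶠ ε in nhdsWithin (0 : ℝ) (Set.Ioi 0), 0 < ε := self_mem_nhdsWithin
  filter_upwards [hpos, eventually_mul_rpow_le_half 1 zero_lt_one,
    eventually_mul_rpow_le_half 1 (zero_lt_one.trans hβ),
    eventually_mul_rpow_le_half 1 hβ₁, eventually_mul_rpow_le_half 1 hβ₂,
    eventually_mul_rpow_le_half (2 ^ N) (mul_pos (sub_pos.2 hβ) hL0),
    eventually_mul_rpow_le_half (2 ^ N) (sub_pos.2 h1),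
    eventually_mul_rpow_le_half (2 ^ L * 2 ^ N) (sub_pos.2 h2),
    eventually_mul_rpow_le_half (2 ^ N) (sub_pos.2 h1'),
    eventually_mul_rpow_le_half (2 ^ N) (sub_pos.2 h2')] with ε hε e0 eβ e1 e2 b1 b2 b3 b4 b5
  rw [one_mul] at e0 eβ e1 e2
  rw [Real.rpow_one] at e0
  have hεβ : 0 < ε ^ β := Real.rpow_pos_of_pos hε β
  have hR : (1 / ε) ^ β = (ε ^ β)⁻¹ := by rw [one_div, Real.inv_rpow hε.le]
  have hL : ε ^ L = ε ^ (L : ℝ) := (Real.rpow_natCast ε L).symm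
  have hpow : ∀ (b : ℝ) (n : ℕ), (ε ^ b) ^ n = ε ^ (b * n) := fun b n =>
    (Real.rpow_mul_natCast hε.le b n).symm
  refine wellSeparated_of_bounds hε (by linarith) rfl ?_ (Real.rpow_pos_of_pos hε _) e1
    (Real.rpow_pos_of_pos hε _) e2 ?_ ?_ ?_ ?_ ?_
  · rw [hR, ← inv_inv (2 : ℝ)]
    exact inv_anti₀ hεβ (by simpa using eβ)
  · have e : (1 / ε) ^ L = ε ^ ((β - 1) * L) * ((1 / ε) ^ β) ^ L := by
      rw [hR, inv_pow, hpow, one_div, inv_pow, hL, ← Real.rpow_neg hε.le, ← Real.rpow_neg hε.le,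
        ← Real.rpow_add hε]
      congr 1; ring
    rw [e, ← mul_assoc]
    exact mul_le_mul_of_nonneg_right b1 (by positivity)
  · have e : (ε ^ β₁) ^ L = ε ^ (β₁ * (L - N) - L) * (ε ^ L * (ε ^ β₁) ^ N) := by
      rw [hpow, hpow, hL, ← Real.rpow_add hε, ← Real.rpow_add hε]
      congr 1; ring
    rw [e, ← mul_assoc]
    exact mul_le_mul_of_nonneg_right b2 (by positivity)
  · have e : (ε ^ β₂) ^ N = ε ^ (β₂ * N - L) * ε ^ L := by
      rw [hpow, hL, ← Real.rpow_add hε]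
      congr 1; ring
    rw [e, ← mul_assoc]
    exact mul_le_mul_of_nonneg_right b3 (by positivity)
  · have e : ε ^ L = ε ^ (L - β₁ * N) * (ε ^ β₁) ^ N := by
      rw [hpow, hL, ← Real.rpow_add hε]
      congr 1; ring
    rw [e, ← mul_assoc]
    exact mul_le_mul_of_nonneg_right b4 (by positivity)
  · have e : ε ^ L = ε ^ (L - β₂ * (N - 1)) * (ε ^ β₂) ^ (N - 1) := by
      rw [hpow, hL, ← Real.rpow_add hε, Nat.cast_sub hN, Nat.cast_one]
      congr 1; ring
    rw [e, ← mul_assoc]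
    exact mul_le_mul_of_nonneg_right b5 (by positivity)

theorem WellSeparated.nonsingular {L N : ℕ} {R' ε' R ε₁ ε₂ : ℝ}
    (W : WellSeparated L N R' ε' R ε₁ ε₂) {ζ : ℂ} (hζ : ‖ζ‖ = 1) {z : ℂ}
    (hz : z ∈ zSupport R' ε') {w : Fin N → ℂ} (hw : ∀ i, w i ∈ wSupport R ε₁ ε₂) :
    z ≠ 0 ∧ p L N ζ z w ≠ 0 ∧ ∀ i, w i ≠ 0 ∧ w i ≠ 1 ∧ q L N z (w i) ≠ 0 := by
  refine ⟨W.z_ne_zero hz, ?_, fun i => ⟨W.w_ne_zero (hw i), W.w_ne_one (hw i), ?_⟩⟩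
  · rw [p_eq]
    refine one_sub_ne_zero_of_norm ?_
    rcases hz with hz | hz
    · exact Or.inl (W.prodRatio_large ζ hζ z hz w hw)
    · by_cases hall : ∀ i, w i ∈ sphere (1 : ℂ) ε₂
      · exact Or.inl (W.prodRatio_small_of_all ζ hζ z hz w hall)
      · push Not at hall
        obtain ⟨i, hi⟩ := hall
        exact Or.inr (W.prodRatio_small ζ hζ z hz w hw ⟨i, (hw i).resolve_right hi⟩)
  · rw [q_eq]
    refine one_sub_ne_zero_of_norm ?_
    rcases hw i with (h | h) | h
    · exact Or.inl (W.ratio_outer z hz _ h)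
    · exact Or.inr (W.ratio_inner z hz _ (Or.inl h))
    · exact Or.inr (W.ratio_inner z hz _ (Or.inr h))

end PushASEP

end

/-! ### Conclusion. -/

theorem propositionp (L N : ℕ) (hN : 1 ≤ N) (hNL : 2 * N < L) (β β₁ β₂ : ℝ) :
    ∃ ε₀ : ℝ, 0 < ε₀ ∧ ∀ R' ε' R ε₁ ε₂ : ℝ, 0 < ε' → ε' < ε₀ →
      PushASEP.Admissible L N β β₁ β₂ R' ε' R ε₁ ε₂ →
      ∀ ζ : ℂ, ‖ζ‖ = 1 →
        (∀ z ∈ PushASEP.zSupport R' ε', ∀ w : Fin N → ℂ,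
          (∀ i, w i ∈ PushASEP.wSupport R ε₁ ε₂) →
            z ≠ 0 ∧ PushASEP.p L N ζ z w ≠ 0 ∧
              ∀ i, w i ≠ 0 ∧ w i ≠ 1 ∧ PushASEP.q L N z (w i) ≠ 0) ∧
        ∀ X ∈ PushASEP.configs L N, ∀ Y ∈ PushASEP.configs L N,
          PushASEP.nestedContour N R' ε' R ε₁ ε₂ (PushASEP.integrand L N ζ X Y) =
              (if X = Y then 1 else 0) ∧
          PushASEP.nestedContour N R' ε' R ε₁ ε₂
              (fun z w => PushASEP.integrand L N ζ X Y z w * ∏ i, ζ ^ (X i - Y i)) =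
              (if X = Y then 1 else 0) := by
  -- The threshold must be chosen before admissibility is assumed. For exponents outside the allowed
  -- range nothing is admissible, so any positive threshold, such as 1, works.
  by_cases hβ : 1 < β ∧ (L : ℝ) / ((L : ℝ) - N) < β₁ ∧ β₁ < (L : ℝ) / N ∧ (L : ℝ) / N < β₂ ∧
      β₂ * ((N : ℝ) - 1) < L
  · obtain ⟨h0, h1, h1', h2, h2'⟩ := hβ
    obtain ⟨ε₀, hε₀, hW⟩ := mem_nhdsGT_iff_exists_Ioo_subset.1
      (PushASEP.eventually_wellSeparated hN hNL h0 h1 h1' h2 h2')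
    refine ⟨ε₀, hε₀, ?_⟩
    intro R' ε' R ε₁ ε₂ hε' hlt A ζ hζ
    have W : PushASEP.WellSeparated L N R' ε' R ε₁ ε₂ := by
      have := hW ⟨hε', hlt⟩
      rw [A.R_eq, A.R'_eq, A.ε₁_eq, A.ε₂_eq]
      exact this
    refine ⟨fun z hz w hw => W.nonsingular hζ hz hw, fun X hX Y hY => ?_⟩
    have key := W.nestedContour_integrand hN (by omega) hζ hX hY
    refine ⟨key, ?_⟩
    -- The extra factor is constant in the integration variables and equals 1 when `X = Y`.
    rw [PushASEP.nestedContour_mul_const, key]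
    split_ifs with hXY
    · simp [hXY]
    · simp
  · refine ⟨1, one_pos, fun R' ε' R ε₁ ε₂ _ _ A => absurd ?_ hβ⟩
    exact ⟨A.one_lt_β, A.lt_β₁, A.β₁_lt, A.lt_β₂, A.β₂_lt⟩
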